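/- Let $\lambda$ be a regular uncountable cardinal such that $\mathrm{GCH}$ holds below $\lambda$ (i.e. $2^\kappa=\kappa^+$ for every infinite cardinal $\kappa<\lambda$). A set $S\subseteq\lambda$ is \emph{fat} if for every (infinite) regular cardinal $\theta<\lambda$ and every club $C\subseteq\lambda$, the set $S\cap C$ contains a closed subset of order type $\theta+1$. Let $\mathbb P$ be a notion of forcing, where $p\le q$ means that $q$ extends $p$. An \emph{explicit $\mathbb P$-name for a subset of $\lambda$} is a partial map $\sigma:\mathbb P\rightharpoonup 2^{<\lambda}$ such that (i) if $p\le q$ are in $\operatorname{dom}\sigma$ then $\sigma(q)$ extends $\sigma(p)$; (ii) for every $\gamma<\lambda$, the set of $p\in\operatorname{dom}\sigma$ with $|\sigma(p)|\ge\gamma$ is dense in $\mathbb P$ (here $|s|=\operatorname{dom}s$ is the length of the string $s$). Let $W_\sigma$ be the $\mathbb P$-name for the set $\{\alpha<\lambda : (\exists p\in G\cap\operatorname{dom}\sigma)\ \alpha<|\sigma(p)|\text{ and }\sigma(p)(\alpha)=1\}$, where $G$ is the generic filter. For an increasing sequence $\bar p=\langle p_i\rangle_{i<i^*}$ ($i^*<\lambda$)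 of conditions in $\operatorname{dom}\sigma$ let $\sigma(\bar p)=\bigcup_{i<i^*}\sigma(p_i)$. An \emph{exact sparse upper bound} of $\bar p$ is an upper bound $p\in\operatorname{dom}\sigma$ of $\bar p$ with $\sigma(p)=\sigma(\bar p)^\frown 0$. A \emph{choice of sparse upper bounds} is a partial function $f$, defined on a collection of such increasing sequences, such that $f(\bar p)$ is an exact sparse upper bound of $\bar p$ for every $\bar p\in\operatorname{dom}f$. An increasing sequence $\bar p=\langle p_i\rangle_{i<i^*}$ in $\operatorname{dom}\sigma$ is \emph{sparse} (for $\sigma$ and $f$) if $|\sigma(p_i)|<|\sigma(p_j)|$ for all $i<j<i^*$, and for every (nonzero) limit ordinal $i<i^*$, $f(\bar p\restriction i)$ is defined and equals $p_i$. For $S\subseteq\lambda$, an \emph{$S$-sparse $\mathbb P$-name} is a pair $(\sigma,f)$ of an explicit $\mathbb P$-name $\sigma$ for a subset of $\lambda$ and a choice $f$ of sparse upper bounds for $\sigma$, such that $f(\bar p)$ is defined for every sparse sequence $\bar p$ of limit length with $|\sigma(\bar p)|\in S$. \textbf{Proposition.} Suppose that $S\subseteq\lambda$ is fat and that $(\sigma,f)$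 is an $S$-sparse $\mathbb P$-name. Then $\mathbb P$ is ${<}\lambda$-distributive (the intersection of fewer than $\lambda$ dense open subsets of $\mathbb P$ is dense open), and $S\setminus W_\sigma$ is fat in $V^{\mathbb P}$, i.e. every condition of $\mathbb P$ forces that $S\setminus W_\sigma$ is a fat subset of $\lambda$. -/

import Mathlib

universe u

open Cardinal Set

noncomputable section

/-! ### Ordinals, club sets and fat sets in the ground model

The universe `V` is `Type u`; its ordinals are the elements of `Ordinal.{u}`.  A set of ordinals
`S ⊆ lam` is a `Set Ordinal.{u}` contained in `Set.Iio lam.ord`. -/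

/-- `D` contains each of its limit points below `o`. -/
def ClosedBelow (D : Set Ordinal.{u}) (o : Ordinal.{u}) : Prop :=
  ∀ δ < o, δ ≠ 0 → (∀ ξ < δ, ∃ η ∈ D, ξ < η ∧ η < δ) → δ ∈ D

/-- `C` is a closed unbounded subset of the ordinal `o`. -/
structure ClubIn (C : Set Ordinal.{u}) (o : Ordinal.{u}) : Prop where
  subset : C ⊆ Iio o
  unbounded : ∀ ξ < o, ∃ η ∈ C, ξ < η
  closed : ClosedBelow C o

/-- `S` is a fat subset of `lam`: for every regular `θ < lam` and every club `C` of `lam`,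
`S ∩ C` contains a closed set of order type `θ + 1`. -/
def IsFat (lam : Cardinal.{u}) (S : Set Ordinal.{u}) : Prop :=
  S ⊆ Iio lam.ord ∧
    ∀ θ : Cardinal.{u}, θ.IsRegular → θ < lam → ∀ C : Set Ordinal.{u}, ClubIn C lam.ord →
      ∃ D : Set Ordinal.{u}, D ⊆ S ∩ C ∧ ClosedBelow D lam.ord ∧
        Nonempty (Iio (θ.ord + 1) ≃o D)

/-- `GCH` holds below `lam`. -/
def GCHBelow (lam : Cardinal.{u}) : Prop :=
  ∀ κ : Cardinal.{u}, ℵ₀ ≤ κ → κ < lam → (2 : Cardinal.{u}) ^ κ = Order.succ κ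

/-! ### Notions of forcing

A notion of forcing is a preorder `P`; `p ≤ q` means that `q` extends (is stronger than) `p`. -/

/-- Dense open subsets of a notion of forcing. -/
structure DenseOpen {P : Type u} [Preorder P] (U : Set P) : Prop where
  dense : ∀ p, ∃ q, p ≤ q ∧ q ∈ U
  isOpen : ∀ p ∈ U, ∀ q, p ≤ q → q ∈ U

/-- `P` is `< lam`-distributive: the intersection of fewer than `lam` dense open sets is dense
open. -/
def IsDistributive (P : Type u) [Preorder P] (lam : Cardinal.{u}) : Prop :=
  ∀ (ι : Type u), #ι < lam → ∀ U : ι → Set P, (∀ i, DenseOpen (U i)) → DenseOpen (⋂ i, U i)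

/-- A `P`-name is a set of pairs `(x, p)` with `x` a `P`-name and `p ∈ P`; the name
`mk ι elt cond` is the set of all pairs `(elt i, p)` with `p ∈ cond i`. -/
inductive PName (P : Type u) : Type (u + 1)
  | mk (ι : Type u) (elt : ι → PName P) (cond : ι → Set P) : PName P

/-- A statement of the forcing language, given by the set of conditions which force it:
`φ p` says `p ⊩ φ`. -/
abbrev Stmt (P : Type u) := P → Prop

namespace Stmt

variable {P : Type u} [Preorder P]

/-- `p ⊩ ¬φ` iff no extension of `p` forces `φ`. -/
protected def not (φ : Stmt P) : Stmt P := fun p => ∀ q, p ≤ q → ¬ φ q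

protected def and (φ ψ : Stmt P) : Stmt P := fun p => φ p ∧ ψ p

/-- `p ⊩ φ → ψ` iff every extension of `p` which forces `φ` forces `ψ`. -/
protected def imp (φ ψ : Stmt P) : Stmt P := fun p => ∀ q, p ≤ q → φ q → ψ q

/-- `p ⊩ ∀ x, φ x` iff `p ⊩ φ x` for every `P`-name `x`. -/
protected def all (φ : PName P → Stmt P) : Stmt P := fun p => ∀ x, φ x p

/-- `p ⊩ ∃ x, φ x` iff the conditions forcing `φ x` for some `P`-name `x` are dense above `p`. -/
protected def ex (φ : PName P → Stmt P) : Stmt P := fun p =>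
  ∀ q, p ≤ q → ∃ r, q ≤ r ∧ ∃ x, φ x r

end Stmt

namespace PName

variable {P : Type u} [Preorder P]

/-- The forcing relation for equality: `p ⊩ x = y` iff for all `(a, r) ∈ x` and all `q ≥ p, r`,
it is dense above `q` that there is `(b, r') ∈ y` such that `s ≥ r'` and `s ⊩ a = b`; and
symmetrically with `x` and `y` exchanged. -/
def eq : PName P → PName P → Stmt P
  | mk _ a c, mk _ b d => fun p =>
    (∀ i, ∀ q, p ≤ q → (∃ r ∈ c i, r ≤ q) → ∀ q', q ≤ q' →
      ∃ s, q' ≤ s ∧ ∃ j, (∃ r ∈ d j, r ≤ s) ∧ eq (a i) (b j) s) ∧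
    (∀ j, ∀ q, p ≤ q → (∃ r ∈ d j, r ≤ q) → ∀ q', q ≤ q' →
      ∃ s, q' ≤ s ∧ ∃ i, (∃ r ∈ c i, r ≤ s) ∧ eq (a i) (b j) s)

/-- The forcing relation for membership: `p ⊩ x ∈ y` iff it is dense above `p` that there is
`(b, r) ∈ y` such that `s ≥ r` and `s ⊩ x = b`. -/
def mem (x : PName P) : PName P → Stmt P
  | mk _ b d => fun p =>
    ∀ q, p ≤ q → ∃ s, q ≤ s ∧ ∃ j, (∃ r ∈ d j, r ≤ s) ∧ eq x (b j) s

/-- The statement `∀ x ∈ A, φ x`. -/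
def allMem (A : PName P) (φ : PName P → Stmt P) : Stmt P :=
  Stmt.all fun x => (mem x A).imp (φ x)

/-- The statement `∃ x ∈ A, φ x`. -/
def exMem (A : PName P) (φ : PName P → Stmt P) : Stmt P :=
  Stmt.ex fun x => (mem x A).and (φ x)

/-- The canonical name `x̌` of a ground model set `x`. -/
def check : PSet.{u} → PName P
  | PSet.mk ι A => mk ι (fun i => check (A i)) (fun _ => univ)

/-- A name for the unordered pair `{x, y}`. -/
def upair (x y : PName P) : PName P :=
  mk (ULift Bool) (fun b => if b.down then x else y) (fun _ => univ)

/-- A name for the (Kuratowski) ordered pair `(x, y)`. -/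
def pair (x y : PName P) : PName P := upair (upair x x) (upair x y)

/-- A name for the successor `x ∪ {x}`. -/
def succ : PName P → PName P
  | mk ι a c => mk (Option ι) (fun o => o.elim (mk ι a c) a) (fun o => o.elim univ c)

/-- A name for the difference `x ∖ y`: it consists of the pairs `(a, p)` such that, for some
`(a, r) ∈ x`, the condition `p` extends `r` and forces `a ∉ y`. -/
def sdiff : PName P → PName P → PName P
  | mk ι a c, y => mk ι a fun i => {p | (∃ r ∈ c i, r ≤ p) ∧ (mem (a i) y).not p}

/-! The following are statements of the forcing language.  Ordinals are von Neumann ordinals, so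
that `∈` is their order. -/

/-- `x ⊆ y` -/
def subset (x y : PName P) : Stmt P := allMem x fun z => mem z y

/-- `f` is a function from `A` to `B`. -/
def isFun (f A B : PName P) : Stmt P :=
  (allMem f fun z => exMem A fun x => exMem B fun y => eq z (pair x y)).and <|
  (allMem A fun x => exMem B fun y => mem (pair x y) f).and <|
  allMem A fun x => allMem B fun y => allMem B fun y' =>
    (mem (pair x y) f).imp ((mem (pair x y') f).imp (eq y y'))

/-- `f` is an order isomorphism (with respect to `∈`) from `A` onto `B`, both being sets of
ordinals. -/
def isOrderIso (f A B : PName P) : Stmt P :=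
  (isFun f A B).and <|
  (allMem B fun y => exMem A fun x => mem (pair x y) f).and <|
  allMem A fun x => allMem A fun x' => allMem B fun y => allMem B fun y' =>
    (mem (pair x y) f).imp ((mem (pair x' y') f).imp ((mem x x').imp (mem y y')))

/-- `D` contains each of its limit points below the ordinal `L`. -/
def closedBelow (D L : PName P) : Stmt P :=
  allMem L fun δ => (Stmt.ex fun ξ => mem ξ δ).imp <|
    (allMem δ fun ξ => exMem D fun η => (mem ξ η).and (mem η δ)).imp (mem δ D)

/-- `C` is a club of the ordinal `L`. -/
def isClub (C L : PName P) : Stmt P :=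
  (subset C L).and <| (allMem L fun ξ => exMem C fun η => mem ξ η).and (closedBelow C L)

/-- The ordinal `θ` is an (infinite) regular cardinal: it is a nonzero limit ordinal, and no
function from a smaller ordinal to `θ` is unbounded in `θ`. -/
def isRegular (θ : PName P) : Stmt P :=
  (Stmt.ex fun x => mem x θ).and <|
  (allMem θ fun x => exMem θ fun y => mem x y).and <|
  allMem θ fun β => Stmt.all fun f => (isFun f β θ).imp <|
    exMem θ fun γ => allMem β fun x => allMem θ fun y => (mem (pair x y) f).imp (mem y γ)

/-- `X` is a fat subset of the cardinal `L`: for every regular `θ < L` and every club `C` of `L`,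
`X ∩ C` contains a closed set `D` of order type `θ + 1`. -/
def isFat (L X : PName P) : Stmt P :=
  (subset X L).and <|
  allMem L fun θ => (isRegular θ).imp <|
    Stmt.all fun C => (isClub C L).imp <|
      Stmt.ex fun D => (subset D X).and <| (subset D C).and <| (closedBelow D L).and <|
        Stmt.ex fun f => isOrderIso f (succ θ) D

end PName

/-- The ground model set of (von Neumann) ordinals `{α < lam | α ∈ S}`. -/
def ordSet (lam : Cardinal.{u}) (S : Set Ordinal.{u}) : PSet.{u} :=
  PSet.mk {a : lam.ord.ToType // (a : Ordinal.{u}) ∈ S} fun a => (a.1 : Ordinal.{u}).toPSet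

/-! ### Sparse names -/

/-- A binary string, i.e. a function from an ordinal `length` to `2`, identified with the set of
places at which it takes the value `1` (together with its length). -/
structure BinString : Type (u + 1) where
  length : Ordinal.{u}
  ones : Set Ordinal.{u}
  ones_subset : ones ⊆ Iio length

namespace BinString

/-- `s ≼ t`: the string `t` extends the string `s`. -/
def Prefix (s t : BinString.{u}) : Prop :=
  s.length ≤ t.length ∧ s.ones = t.ones ∩ Iio s.length

/-- The string `s ⌢ 0`. -/
def appendZero (s : BinString.{u}) : BinString.{u} where
  length := s.length + 1
  ones := s.ones
  ones_subset := fun _ h => mem_Iio.2 ((mem_Iio.1 (s.ones_subset h)).trans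
    (Order.lt_add_one_iff.2 le_rfl))

end BinString

/-- A sequence `⟨p_i : i < len⟩` of elements of `A`, of ordinal length. -/
structure TSeq (A : Type u) : Type (u + 1) where
  len : Ordinal.{u}
  val : Iio len → A

namespace TSeq

variable {A : Type u}

/-- The restriction of a sequence to an ordinal at most its length. -/
def restrict (s : TSeq A) (i : Ordinal.{u}) (hi : i ≤ s.len) : TSeq A where
  len := i
  val := fun j => s.val ⟨j.1, lt_of_lt_of_le j.2 hi⟩

/-- The sequence is (weakly) increasing. -/
def Increasing [Preorder A] (s : TSeq A) : Prop :=
  ∀ i j : Iio s.len, i < j → s.val i ≤ s.val j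

end TSeq

/-- An explicit `P`-name for a subset of `lam`: a partial map from `P` to `2^{<lam}`, defined on
`dom`. -/
structure ExplicitName (P : Type u) [Preorder P] (lam : Cardinal.{u}) where
  dom : Set P
  str : dom → BinString.{u}
  length_lt : ∀ p, (str p).length < lam.ord
  mono : ∀ p q : dom, p ≤ q → (str p).Prefix (str q)
  dense : ∀ γ < lam.ord, ∀ p : P, ∃ q : dom, p ≤ (q : P) ∧ γ ≤ (str q).length

namespace ExplicitName

variable {P : Type u} [Preorder P] {lam : Cardinal.{u}} (σ : ExplicitName P lam)

/-- The union `σ(p̄)` of the strings `σ(p_i)`, for a sequence `p̄` of conditions in `dom σ`. -/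
def seqStr (s : TSeq σ.dom) : BinString.{u} where
  length := ⨆ i, (σ.str (s.val i)).length
  ones := ⋃ i, (σ.str (s.val i)).ones
  ones_subset := by
    intro α hα
    obtain ⟨i, hi⟩ := mem_iUnion.1 hα
    exact lt_of_lt_of_le ((σ.str (s.val i)).ones_subset hi)
      (le_ciSup (f := fun i => (σ.str (s.val i)).length) Ordinal.bddAbove_of_small i)

/-- `p` is an exact sparse upper bound of `p̄`: an upper bound in `dom σ` with
`σ(p) = σ(p̄) ⌢ 0`. -/
def ExactSparseUpperBound (s : TSeq σ.dom) (p : σ.dom) : Prop :=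
  (∀ i, s.val i ≤ p) ∧ σ.str p = (σ.seqStr s).appendZero

/-- `f` is a choice of sparse upper bounds: a partial function, defined on a collection of
increasing sequences (of length below `lam`) of conditions from `dom σ`, whose values are exact
sparse upper bounds. -/
def IsChoice (f : TSeq σ.dom →. σ.dom) : Prop :=
  ∀ s, ∀ p ∈ f s, s.Increasing ∧ s.len < lam.ord ∧ σ.ExactSparseUpperBound s p

/-- `p̄` is a sparse sequence for `σ` and `f`: it is increasing, the lengths of the strings
`σ(p_i)` are strictly increasing, and for every limit `i`, `f(p̄ ↾ i)` is defined and equals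
`p_i`. -/
structure IsSparseSeq (f : TSeq σ.dom →. σ.dom) (s : TSeq σ.dom) : Prop where
  len_lt : s.len < lam.ord
  increasing : s.Increasing
  length_lt : ∀ i j : Iio s.len, i < j → (σ.str (s.val i)).length < (σ.str (s.val j)).length
  limit : ∀ i : Iio s.len, Order.IsSuccLimit (i : Ordinal.{u}) →
    s.val i ∈ f (s.restrict i (le_of_lt i.2))

/-- The `P`-name `W_σ = {(α, p) | p ∈ dom σ, α < |σ(p)|, σ(p)(α) = 1}` of the subset of `lam`
described by `σ`. -/
def W : PName P :=
  PName.mk lam.ord.ToType (fun a => PName.check (a : Ordinal.{u}).toPSet)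
    (fun a => {p | ∃ h : p ∈ σ.dom, (a : Ordinal.{u}) ∈ (σ.str ⟨p, h⟩).ones})

end ExplicitName

/-- An `S`-sparse `P`-name for a subset of `lam`: an explicit name `σ` together with a choice `cb`
of sparse upper bounds for `σ`, such that `cb` is defined at every sparse sequence `p̄` of limit
length with `|σ(p̄)| ∈ S`. -/
structure SparseName (P : Type u) [Preorder P] (lam : Cardinal.{u}) (S : Set Ordinal.{u})
    extends ExplicitName P lam where
  cb : TSeq toExplicitName.dom →. toExplicitName.dom
  isChoice : toExplicitName.IsChoice cb
  defined : ∀ s : TSeq toExplicitName.dom, toExplicitName.IsSparseSeq cb s →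
    Order.IsSuccLimit s.len → (toExplicitName.seqStr s).length ∈ S → (cb s).Dom

end

-- Everything rests on one construction, `SparseName.exists_run`: for regular κ < lam, a rule for
-- extending conditions can be iterated along a sparse sequence ⟨r_i : i ≤ κ⟩. Successor steps are
-- free. At a limit i the choice function supplies r_i, with value 0 at δ, provided that the
-- supremum δ of the earlier lengths lies in S. So the lengths must be steered into S although the
-- length of a single extension is not under control.
--
-- The steering uses an increasing sequence a in a club C, with limit suprema in S, such that a_i ≤
-- |σ(r_{i+1})| < a_{i+1}. The lower bound is imposed on the extension. The upper bound holds if C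
-- consists of closure points of some h with |σ(r_{i+1})| < h(a_i). Since r_{i+1} depends on all of
-- a ↾ (i+1), h(β) must bound the outcomes of all histories ending in β, and there must be fewer
-- than lam of these. `exists_guessing_family` provides such histories. If lam is a limit cardinal,
-- GCH leaves few short sequences below β. If lam = μ⁺, only sequences with bounded image under an
-- injection of β into μ are counted. For κ ≤ cof μ boundedness is automatic; otherwise fatness is
-- applied at (2^κ)⁺, and an Erdős–Rado homogeneous subsequence of length κ has a uniform bound.
--
-- Distributivity follows by meeting κ dense open sets along a run, singular cardinals being split
-- along a cofinal set. For fatness, an ω-run that interleaves lengths with elements of a named club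
-- yields δ in S forced into the club and out of W_σ. A κ-run of such steps lists a closed set of
-- type κ + 1, already in the ground model.

universe v w

/-! ### Small families and cardinal arithmetic under GCH -/

/-- The set `F` is indexed by a type of cardinality less than `c`. -/
def Few (c : Cardinal.{u}) {α : Type v} (F : Set α) : Prop :=
  ∃ J : Type u, #J < c ∧ ∃ φ : J → α, F ⊆ range φ

theorem Few.exists_bound_of_cof {o : Ordinal.{u}} (ho : Order.IsSuccLimit o) {α : Type v}
    {F : Set α} (hF : Few o.cof F) (X : α → Ordinal.{u}) (hX : ∀ g ∈ F, X g < o) :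
    ∃ b < o, ∀ g ∈ F, X g < b := by
  classical
  obtain ⟨J, hJ, φ, hφ⟩ := hF
  let Y : J → Ordinal.{u} := fun j => if φ j ∈ F then X (φ j) + 1 else 0
  refine ⟨⨆ j, Y j, Ordinal.iSup_lt_of_lt_cof hJ fun j => ?_, fun g hg => ?_⟩
  · by_cases h : φ j ∈ F
    · simpa [Y, h] using ho.succ_lt (hX _ h)
    · simpa [Y, h] using ho.bot_lt
  · obtain ⟨j, rfl⟩ := hφ hg
    have : Y j ≤ ⨆ j, Y j := le_ciSup (Ordinal.bddAbove_of_small (s := range Y)) j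
    refine lt_of_lt_of_le ?_ this
    simp [Y, hg]

theorem Few.exists_bound {c : Cardinal.{u}} (hc : c.IsRegular) {α : Type v} {F : Set α}
    (hF : Few c F) (X : α → Ordinal.{u}) (hX : ∀ g ∈ F, X g < c.ord) :
    ∃ b < c.ord, ∀ g ∈ F, X g < b :=
  Few.exists_bound_of_cof (isSuccLimit_ord hc.1) (by rwa [hc.cof_ord]) X hX

theorem Few.biUnion {c : Cardinal.{u}} (hc : c.IsRegular) {β : Type w} {α : Type v} {I : Set β}
    (hI : Few c I) {F : β → Set α} (hF : ∀ i ∈ I, Few c (F i)) : Few c (⋃ i ∈ I, F i) := by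
  obtain ⟨J, hJ, φ, hφ⟩ := hI
  choose K hK ψ hψ using fun j : {j : J // φ j ∈ I} => hF _ j.2
  refine ⟨Σ j, K j, ?_, fun x => ψ x.1 x.2, ?_⟩
  · rw [mk_sigma]
    exact sum_lt_of_isRegular hc ((mk_subtype_le _).trans_lt hJ) hK
  · intro a ha
    simp only [mem_iUnion] at ha
    obtain ⟨i, hi, ha⟩ := ha
    obtain ⟨j, rfl⟩ := hφ hi
    obtain ⟨k, rfl⟩ := hψ ⟨j, hi⟩ ha
    exact ⟨⟨⟨j, hi⟩, k⟩, rfl⟩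

theorem few_Iio {c : Cardinal.{u}} {o : Ordinal.{u}} (h : o.card < c) : Few c (Iio o) :=
  ⟨o.ToType, by simpa using h, fun x => x, fun a ha => ⟨Ordinal.ToType.mk ⟨a, ha⟩, by simp⟩⟩

/-- The sequences of length `i` of ordinals below `β` whose images under `e` are below `ν`,
extended by zero. -/
def boundedSeqs (e : Ordinal.{u} → Ordinal.{u}) (i ν β : Ordinal.{u}) :
    Set (Ordinal.{u} → Ordinal.{u}) :=
  {g | (∀ j < i, g j < β ∧ e (g j) < ν) ∧ ∀ j, i ≤ j → g j = 0}

/-- As `e` is injective below `β`, a sequence is recovered from its image, a function from `i` to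
`ν`. -/
theorem few_boundedSeqs {c : Cardinal.{u}} {e : Ordinal.{u} → Ordinal.{u}} {i ν β : Ordinal.{u}}
    (he : InjOn e (Iio β)) (h : ν.card ^ i.card < c) : Few c (boundedSeqs e i ν β) := by
  classical
  refine ⟨i.ToType → ν.ToType, by simpa using h, fun t j =>
    if hj : j < i then Function.invFunOn e (Iio β) (t (Ordinal.ToType.mk ⟨j, hj⟩)) else 0, ?_⟩
  rintro g ⟨hg, hg0⟩
  refine ⟨fun x => Ordinal.ToType.mk ⟨e (g x), (hg x (Ordinal.ToType.mk.symm x).2).2⟩, ?_⟩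
  funext j
  by_cases hj : j < i
  · simp only [hj, dif_pos, OrderIso.symm_apply_apply]
    exact he.leftInvOn_invFunOn (hg j hj).1
  · simp [hj, hg0 j (not_lt.1 hj)]

theorem GCHBelow.power_le {lam m a b : Cardinal.{u}} (hGCH : GCHBelow lam) (hm : ℵ₀ ≤ m)
    (hml : m ≤ lam) (ha : a < m) (hb : b < m) : a ^ b ≤ m := by
  rcases lt_or_ge (max a b) ℵ₀ with h | h
  · exact (power_lt_aleph0 ((le_max_left _ _).trans_lt h) ((le_max_right _ _).trans_lt h)).le.trans hm
  · calc a ^ b ≤ (max a b) ^ (max a b) :=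
        (power_le_power_right (le_max_left _ _)).trans
          (power_le_power_left (ne_of_gt (lt_of_lt_of_le aleph0_pos h)) (le_max_right _ _))
      _ = 2 ^ max a b := power_self_eq h
      _ = Order.succ (max a b) := hGCH _ h ((max_lt ha hb).trans_le hml)
      _ ≤ m := Order.succ_le_of_lt (max_lt ha hb)

/-! ### A case of the Erdős–Rado theorem -/

/-- The canonical end-homogeneous sequence for the colouring `c` below `ζ`. -/
noncomputable def endHomSeq {χ : Type u} (c : Ordinal.{u} → Ordinal.{u} → χ) (ζ i : Ordinal.{u}) :
    Ordinal.{u} :=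
  sInf {η | ∀ j : Iio i, endHomSeq c ζ j < η ∧ c (endHomSeq c ζ j) η = c (endHomSeq c ζ j) ζ}
termination_by i
decreasing_by exact j.2

section endHomSeq

variable {χ : Type u} {c : Ordinal.{u} → Ordinal.{u} → χ} {ζ i : Ordinal.{u}}

theorem endHomSeq_le (h : ∀ j < i, endHomSeq c ζ j < ζ) : endHomSeq c ζ i ≤ ζ := by
  rw [endHomSeq]
  exact csInf_le' fun j => ⟨h j j.2, rfl⟩

theorem endHomSeq_spec (h : ∀ j < i, endHomSeq c ζ j < ζ) : ∀ j < i,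
    endHomSeq c ζ j < endHomSeq c ζ i ∧
      c (endHomSeq c ζ j) (endHomSeq c ζ i) = c (endHomSeq c ζ j) ζ := by
  intro j hj
  have := csInf_mem (s := {η | ∀ j : Iio i, endHomSeq c ζ j < η ∧
    c (endHomSeq c ζ j) η = c (endHomSeq c ζ j) ζ}) ⟨ζ, fun j => ⟨h j j.2, rfl⟩⟩
  rw [← endHomSeq] at this
  exact this ⟨j, hj⟩

/-- The recursion consults ζ only through the colours of the pairs (x_j, ζ). -/
theorem endHomSeq_congr {ζ' : Ordinal.{u}}
    (h : ∀ j < i, c (endHomSeq c ζ j) ζ = c (endHomSeq c ζ' j) ζ') :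
    endHomSeq c ζ i = endHomSeq c ζ' i := by
  induction i using WellFoundedLT.induction with
  | _ i ih =>
    have ih' : ∀ j < i, endHomSeq c ζ j = endHomSeq c ζ' j := fun j hj =>
      ih j hj fun k hk => h k (hk.trans hj)
    rw [endHomSeq, endHomSeq]
    congr 1
    ext η
    refine forall_congr' fun j => ?_
    rw [h j j.2, ih' j j.2]

end endHomSeq

/-- Otherwise the canonical sequence of every ζ reaches ζ before stage κ. Then ζ is determined by
that stage and the colours seen, which leaves at most 2^κ possibilities. -/
theorem exists_endHomogeneous {κ : Cardinal.{u}} (hκ : ℵ₀ ≤ κ) {χ : Type u} (hχ : #χ ≤ κ)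
    (c : Ordinal.{u} → Ordinal.{u} → χ) :
    ∃ ζ < (Order.succ (2 ^ κ : Cardinal.{u})).ord, ∃ x : Ordinal.{u} → Ordinal.{u},
      ∀ i < κ.ord, x i < ζ ∧ ∀ j < i, x j < x i ∧ c (x j) (x i) = c (x j) ζ := by
  by_contra hcon
  have key : ∀ ζ < (Order.succ (2 ^ κ : Cardinal.{u})).ord, ∃ i < κ.ord, endHomSeq c ζ i = ζ := by
    intro ζ hζ
    by_contra hne
    push Not at hne
    have hlt : ∀ i < κ.ord, endHomSeq c ζ i < ζ := by
      intro i
      induction i using WellFoundedLT.induction with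
      | _ i ih =>
        intro hi
        exact lt_of_le_of_ne (endHomSeq_le fun j hj => ih j hj (hj.trans hi)) (hne i hi)
    exact hcon ⟨ζ, hζ, endHomSeq c ζ, fun i hi => ⟨hlt i hi,
      endHomSeq_spec fun j hj => hlt j (hj.trans hi)⟩⟩
  choose! st hst hst' using key
  let θ := (Order.succ (2 ^ κ : Cardinal.{u})).ord
  let Φ : θ.ToType → κ.ord.ToType × (κ.ord.ToType → χ) := fun z =>
    (Ordinal.ToType.mk ⟨st z, hst _ (Ordinal.ToType.mk.symm z).2⟩,
      fun j => c (endHomSeq c z j) z)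
  have hΦ : Function.Injective Φ := by
    intro z z' hz
    have h1 : st z = st z' := by
      have := congrArg (fun t => ((Ordinal.ToType.mk.symm t.1 : Iio κ.ord) : Ordinal)) hz
      simpa [Φ] using this
    have h2 : ∀ j < κ.ord, c (endHomSeq c z j) z = c (endHomSeq c z' j) z' := by
      intro j hj
      have := congrFun (congrArg Prod.snd hz) (Ordinal.ToType.mk ⟨j, hj⟩)
      simpa [Φ] using this
    have hz1 := hst' z (Ordinal.ToType.mk.symm z).2
    have hz2 := hst' z' (Ordinal.ToType.mk.symm z').2
    have : (z : Ordinal) = z' := by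
      rw [← hz1, ← hz2, ← h1]
      exact endHomSeq_congr fun j hj => h2 j (hj.trans (hst _ (Ordinal.ToType.mk.symm z).2))
    exact Ordinal.ToType.mk.symm.injective (Subtype.ext this)
  have hcard := mk_le_of_injective hΦ
  have hle : #(κ.ord.ToType × (κ.ord.ToType → χ)) ≤ 2 ^ κ := by
    simp only [mk_prod, lift_id, mk_ord_toType, ← power_def]
    refine (mul_le_mul' le_rfl (power_le_power_right hχ)).trans ?_
    rw [power_self_eq hκ]
    exact mul_le_of_le (hκ.trans (cantor κ).le) (cantor κ).le le_rfl
  simp only [θ, mk_ord_toType] at hcard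
  exact absurd (hcard.trans hle) (not_le.2 (Order.lt_succ _))

/-- An unbounded subset of a regular cardinal has an increasing enumeration in that length. -/
theorem exists_strictMono_of_unbounded {κ : Cardinal.{u}} (hκ : κ.IsRegular) {B : Set Ordinal.{u}}
    (hB : ∀ ξ < κ.ord, ∃ b ∈ B, ξ ≤ b ∧ b < κ.ord) :
    ∃ b : Ordinal.{u} → Ordinal.{u}, StrictMono b ∧ ∀ i < κ.ord, b i ∈ B ∧ b i < κ.ord := by
  -- Adding the tail above κ makes the set unbounded, as `enumOrd` requires; the first κ values stay
  -- below the tail.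
  have hU : ¬ BddAbove (B ∪ Ici κ.ord) := by
    rintro ⟨x, hx⟩
    have := hx (Or.inr (le_max_right (x + 1) κ.ord))
    exact absurd ((le_max_left _ _).trans this) (not_le.2 (Order.lt_add_one_iff.2 le_rfl))
  have hlt : ∀ i < κ.ord, Ordinal.enumOrd (B ∪ Ici κ.ord) i < κ.ord := by
    intro i
    induction i using WellFoundedLT.induction with
    | _ i ih =>
      intro hi
      obtain ⟨ξ, hξ, hξ'⟩ := Few.exists_bound hκ (few_Iio (c := κ) (o := i) (lt_ord.1 hi))
        (Ordinal.enumOrd (B ∪ Ici κ.ord)) fun j hj => ih j hj (lt_trans hj hi)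
      obtain ⟨b, hb, hξb, hbκ⟩ := hB ξ hξ
      exact (Ordinal.enumOrd_le_of_forall_lt (Or.inl hb)
        fun j hj => (hξ' j hj).trans_le hξb).trans_lt hbκ
  refine ⟨Ordinal.enumOrd (B ∪ Ici κ.ord), Ordinal.enumOrd_strictMono hU, fun i hi =>
    ⟨(Ordinal.enumOrd_mem hU i).resolve_right (not_le.2 (hlt i hi)), hlt i hi⟩⟩

/-- A case of the Erdős–Rado theorem: `(2 ^ κ)⁺ → (κ)²_χ` for `χ < κ`, `κ` regular. -/
theorem exists_homogeneous {κ : Cardinal.{u}} (hκ : κ.IsRegular) {χ : Type u} (hχ : #χ < κ)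
    (c : Ordinal.{u} → Ordinal.{u} → χ) :
    ∃ x : Ordinal.{u} → Ordinal.{u}, ∃ k : χ,
      ∀ i < κ.ord, x i < (Order.succ (2 ^ κ : Cardinal.{u})).ord ∧
        ∀ j < i, x j < x i ∧ c (x j) (x i) = k := by
  obtain ⟨ζ, hζ, x, hx⟩ := exists_endHomogeneous hκ.1 hχ.le c
  -- Pigeonhole: by regularity some colour towards ζ occurs at unboundedly many indices.
  obtain ⟨k, hk⟩ : ∃ k, ∀ ξ < κ.ord, ∃ b ∈ {j | c (x j) ζ = k}, ξ ≤ b ∧ b < κ.ord := by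
    by_contra hcon
    push Not at hcon
    choose ξ hξ hξ' using hcon
    obtain ⟨b, hb, hb'⟩ := Few.exists_bound hκ (F := (univ : Set χ)) ⟨χ, hχ, id, by simp⟩ ξ
      fun k _ => hξ k
    exact absurd (hξ' (c (x b) ζ) b rfl (hb' _ trivial).le) (not_le.2 hb)
  obtain ⟨b, hbm, hb⟩ := exists_strictMono_of_unbounded hκ hk
  refine ⟨x ∘ b, k, fun i hi => ⟨(hx _ (hb i hi).2).1.trans hζ, fun j hj => ?_⟩⟩
  obtain ⟨h1, h2⟩ := (hx _ (hb i hi).2).2 _ (hbm hj)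
  exact ⟨h1, h2.trans (hb j (hj.trans hi)).1⟩

/-! ### Fat sets, guessing of initial segments, closure points -/

/-- Since the witness is closed and has a top element, suprema of its increasing sequences stay in
`S`. Arbitrary subsequences `x` are admitted because a homogeneous one is selected later. -/
theorem IsFat.exists_seq {lam : Cardinal.{u}} {S : Set Ordinal.{u}} (hS : IsFat lam S)
    {θ : Cardinal.{u}} (hθ : θ.IsRegular) (hθl : θ < lam) {C : Set Ordinal.{u}}
    (hC : ClubIn C lam.ord) :
    ∃ E : Ordinal.{u} → Ordinal.{u}, (∀ j ≤ θ.ord, E j ∈ S ∩ C) ∧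
      (∀ i j, i < j → j ≤ θ.ord → E i < E j) ∧
      ∀ (x : Ordinal.{u} → Ordinal.{u}) (i : Ordinal.{u}), Order.IsSuccLimit i →
        (∀ j < i, x j ≤ θ.ord ∧ ∀ k < j, x k < x j) →
          ∃ δ ∈ S, IsLUB ((fun j => E (x j)) '' Iio i) δ := by
  classical
  obtain ⟨D, hDS, hD, ⟨E⟩⟩ := hS.2 θ hθ hθl C hC
  let E' : Ordinal.{u} → Ordinal.{u} := fun j =>
    if h : j ∈ Iio (θ.ord + 1) then (E ⟨j, h⟩ : Ordinal) else 0
  have hE' : ∀ j (h : j ∈ Iio (θ.ord + 1)), E' j = E ⟨j, h⟩ := fun j h => dif_pos h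
  have hmem : ∀ {j}, j ≤ θ.ord → j ∈ Iio (θ.ord + 1) := fun h => Order.lt_add_one_iff.2 h
  have hED : ∀ j ≤ θ.ord, E' j ∈ D := fun j hj => by
    rw [hE' j (hmem hj)]; exact (E _).2
  have hmono : ∀ i j, i < j → j ≤ θ.ord → E' i < E' j := fun i j hij hj => by
    rw [hE' j (hmem hj), hE' i (hmem (hij.le.trans hj))]
    exact E.strictMono (show (⟨i, _⟩ : Iio (θ.ord + 1)) < ⟨j, _⟩ from hij)
  refine ⟨E', fun j hj => hDS (hED j hj), hmono, fun x i hi hx => ?_⟩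
  have hbdd : BddAbove ((fun j => E' (x j)) '' Iio i) := by
    refine ⟨E' θ.ord, ?_⟩
    rintro _ ⟨j, hj, rfl⟩
    rcases (hx j hj).1.eq_or_lt with h | h
    · simp [h]
    · exact (hmono _ _ h le_rfl).le
  have hne : ((fun j => E' (x j)) '' Iio i).Nonempty := ⟨_, 0, hi.bot_lt, rfl⟩
  have hlub := isLUB_csSup hne hbdd
  have hlt : ∀ j < i, E' (x j) < sSup ((fun j => E' (x j)) '' Iio i) := fun j hj =>
    (hmono _ _ ((hx _ (hi.succ_lt hj)).2 j (Order.lt_succ j)) (hx _ (hi.succ_lt hj)).1).trans_le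
      (hlub.1 ⟨_, hi.succ_lt hj, rfl⟩)
  refine ⟨_, (hDS (hD _ ?_ ?_ ?_)).1, hlub⟩
  · refine lt_of_le_of_lt (csSup_le hne (a := E' θ.ord) ?_) (hS.1 (hDS (hED _ le_rfl)).1)
    rintro _ ⟨j, hj, rfl⟩
    rcases (hx j hj).1.eq_or_lt with h | h
    · simp [h]
    · exact (hmono _ _ h le_rfl).le
  · exact (lt_of_le_of_lt zero_le (hlt 0 hi.bot_lt)).ne'
  · intro ξ hξ
    obtain ⟨_, ⟨j, hj, rfl⟩, hj'⟩ := exists_lt_of_lt_csSup hne hξ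
    exact ⟨_, hED _ (hx j hj).1, hj', hlt j hj⟩

/-- The initial segments of `a` below `o` are guessed by `F` from the next value of `a` on, and
the suprema of `a` at limits are in `S`. -/
structure Guessed (F : Ordinal.{u} → Set (Ordinal.{u} → Ordinal.{u})) (S C : Set Ordinal.{u})
    (o : Ordinal.{u}) (a : Ordinal.{u} → Ordinal.{u}) : Prop where
  strictMono : ∀ i j, i < j → j < o → a i < a j
  mem : ∀ i < o, a i ∈ C
  guess : ∀ i < o, ∃ g ∈ F (a i), ∀ j < i, g j = a j
  limit : ∀ i ≤ o, Order.IsSuccLimit i → ∃ δ ∈ S, IsLUB (a '' Iio i) δ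

theorem exists_guess {a : Ordinal.{u} → Ordinal.{u}} {e : Ordinal.{u} → Ordinal.{u}}
    {κ i ν β : Ordinal.{u}} {N : Set Ordinal.{u}} (hi : i < κ) (hν : ν ∈ N)
    (ha : ∀ j < i, a j < β ∧ e (a j) < ν) :
    ∃ g ∈ ⋃ i ∈ Iio κ, ⋃ ν ∈ N, boundedSeqs e i ν β, ∀ j < i, g j = a j := by
  classical
  refine ⟨fun j => if j < i then a j else 0, ?_, fun j hj => by simp [hj]⟩
  simp only [mem_iUnion]
  refine ⟨i, hi, ν, hν, fun j hj => ?_, fun j hj => ?_⟩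
  · simpa [hj] using ha j hj
  · simp [not_lt.2 hj]

/-- The family depends on κ alone: the club is defined from it afterwards. -/
theorem exists_guessing_family {lam : Cardinal.{u}} (hreg : lam.IsRegular) (hGCH : GCHBelow lam)
    {κ : Cardinal.{u}} (hκ : κ.IsRegular) (hκl : κ < lam) :
    ∃ F : Ordinal.{u} → Set (Ordinal.{u} → Ordinal.{u}), (∀ β < lam.ord, Few lam (F β)) ∧
      ∀ S, IsFat lam S → ∀ C, ClubIn C lam.ord → ∃ a, Guessed F S C κ.ord a := by
  classical
  have hκF : Few lam (Iio κ.ord) := few_Iio (by simpa using hκl)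
  by_cases hsucc : ∃ μ, lam = Order.succ μ
  · obtain ⟨μ, rfl⟩ := hsucc
    have hκμ : κ ≤ μ := Order.lt_succ_iff.1 hκl
    have hμ : ℵ₀ ≤ μ := hκ.1.trans hκμ
    have hemb : ∀ β : Ordinal.{u}, β < (Order.succ μ).ord → ∃ e : Ordinal.{u} → Ordinal.{u},
        InjOn e (Iio β) ∧ ∀ x < β, e x < μ.ord := by
      intro β hβ
      have h1 : #β.ToType ≤ #μ.ord.ToType := by
        simpa using Order.lt_succ_iff.1 (lt_ord.1 hβ)
      obtain ⟨f⟩ := h1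
      refine ⟨fun x => if h : x < β then (f (Ordinal.ToType.mk ⟨x, h⟩) : Ordinal) else 0, ?_, ?_⟩
      · intro x hx y hy hxy
        simp only [mem_Iio] at hx hy
        simp only [hx, hy, dif_pos] at hxy
        exact congrArg Subtype.val (Ordinal.ToType.mk.injective
          (f.injective (Ordinal.ToType.mk.symm.injective (Subtype.ext hxy))))
      · intro x hx
        simp only [hx, dif_pos]
        exact (Ordinal.ToType.mk.symm _).2
    choose! e he he' using hemb
    refine ⟨fun β => ⋃ i ∈ Iio κ.ord, ⋃ ν ∈ Iio μ.ord, boundedSeqs (e β) i ν β, ?_, ?_⟩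
    · intro β hβ
      refine Few.biUnion hreg hκF fun i hi => Few.biUnion hreg (few_Iio (by simp))
        fun ν hν => few_boundedSeqs (he β hβ) ?_
      exact Order.lt_succ_iff.2 (hGCH.power_le hμ (Order.le_succ μ) (lt_ord.1 hν)
        ((lt_ord.1 hi).trans_le hκμ))
    · intro S hS C hC
      rcases lt_or_ge μ.ord.cof κ with hcof | hcof
      · have hκμ' : κ < μ := lt_of_le_of_ne hκμ fun h => by
          rw [← h, hκ.cof_ord] at hcof
          exact lt_irrefl _ hcof
        -- μ is singular here, hence not a successor, so that (2^κ)⁺ = κ⁺⁺ is below μ.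
        have hnreg : ∀ x, ℵ₀ ≤ x → x < μ → Order.succ x < μ := by
          intro x hx hxμ
          refine lt_of_le_of_ne (Order.succ_le_of_lt hxμ) fun h => ?_
          rw [← h, (isRegular_succ hx).cof_ord, h] at hcof
          exact lt_asymm hcof hκμ'
        have h2κ : (2 : Cardinal.{u}) ^ κ = Order.succ κ := hGCH κ hκ.1 hκl
        have hθ : Order.succ (2 ^ κ : Cardinal.{u}) < Order.succ μ := by
          rw [h2κ]
          exact (hnreg _ (hκ.1.trans (Order.le_succ _)) (hnreg _ hκ.1 hκμ')).trans
            (Order.lt_succ _)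
        obtain ⟨E, hE, hEm, hEs⟩ := hS.exists_seq
          (isRegular_succ (hκ.1.trans (cantor κ).le)) hθ hC
        obtain ⟨s, hs, hsc⟩ := Order.exists_cof_eq μ.ord.ToType
        -- Cofinality of `s` yields only `x ≤ k`, hence the `+ 1` in a strict bound.
        have hs' : ∀ x < μ.ord, ∃ k : s, x < (k.1 : Ordinal) + 1 := by
          intro x hx
          obtain ⟨k, hk, hk'⟩ := hs (Ordinal.ToType.mk ⟨x, hx⟩)
          refine ⟨⟨k, hk⟩, Order.lt_add_one_iff.2 ?_⟩
          have := Ordinal.ToType.mk.symm.monotone hk'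
          simpa using (show ((Ordinal.ToType.mk.symm (Ordinal.ToType.mk ⟨x, hx⟩) : Iio μ.ord) :
            Ordinal) ≤ _ from this)
        obtain ⟨k₀, -⟩ := hs' 0 (ord_pos.2 (aleph0_pos.trans_le hμ))
        -- A pair is coloured by an element of `s` bounding the code of the smaller point in the
        -- larger; on a homogeneous set one bound serves all pairs.
        have hc : ∀ x y, ∃ k : s, e (E y) (E x) < μ.ord → e (E y) (E x) < (k.1 : Ordinal) + 1 := by
          intro x y
          by_cases h : e (E y) (E x) < μ.ord
          · obtain ⟨k, hk⟩ := hs' _ h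
            exact ⟨k, fun _ => hk⟩
          · exact ⟨k₀, fun h' => absurd h' h⟩
        choose c hc using hc
        obtain ⟨x, k, hx⟩ := exists_homogeneous hκ
          (by rw [hsc, Ordinal.cof_toType]; exact hcof) c
        refine ⟨fun i => E (x i), fun i j hij hj => hEm _ _ ((hx j hj).2 i hij).1 (hx j hj).1.le,
          fun i hi => (hE _ (hx i hi).1.le).2, fun i hi => ?_, fun i hi hlim => ?_⟩
        · refine exists_guess (a := fun i => E (x i)) (ν := (k.1 : Ordinal) + 1) hi
            ((isSuccLimit_ord hμ).succ_lt (Ordinal.ToType.mk.symm k.1).2) fun j hj => ?_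
          have hlt := hEm _ _ ((hx i hi).2 j hj).1 (hx i hi).1.le
          refine ⟨hlt, ?_⟩
          have := hc (x j) (x i) (he' _ (hS.1 (hE _ (hx i hi).1.le).1) _ hlt)
          rwa [((hx i hi).2 j hj).2] at this
        · exact hEs x i hlim fun j hj => ⟨(hx j (hj.trans_le hi)).1.le, fun k hk =>
            ((hx j (hj.trans_le hi)).2 k hk).1⟩
      · obtain ⟨E, hE, hEm, hEs⟩ := hS.exists_seq hκ hκl hC
        refine ⟨E, fun i j hij hj => hEm _ _ hij hj.le, fun i hi => (hE _ hi.le).2,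
          fun i hi => ?_, fun i hi hlim => ?_⟩
        -- Fewer than κ ≤ cof μ codes are bounded in μ.
        · obtain ⟨ν, hν, hν'⟩ := Few.exists_bound_of_cof (isSuccLimit_ord hμ)
            (few_Iio (o := i) ((lt_ord.1 hi).trans_le hcof)) (fun j => e (E i) (E j))
            fun j hj => he' _ (hS.1 (hE i hi.le).1) _ (hEm _ _ hj hi.le)
          exact exists_guess hi hν fun j hj => ⟨hEm _ _ hj hi.le, hν' j hj⟩
        · exact hEs id i hlim fun j hj => ⟨hj.le.trans hi, fun k hk => hk⟩
  · have hlim : ∀ x < lam, Order.succ x < lam := fun x hx =>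
      lt_of_le_of_ne (Order.succ_le_of_lt hx) fun h => hsucc ⟨x, h.symm⟩
    -- No coding is needed for a limit cardinal: all sequences below β of length less than κ are
    -- admitted.
    refine ⟨fun β => ⋃ i ∈ Iio κ.ord, ⋃ ν ∈ ({β} : Set Ordinal.{u}), boundedSeqs id i ν β, ?_, ?_⟩
    · intro β hβ
      refine Few.biUnion hreg hκF fun i hi => ?_
      simp only [mem_singleton_iff, iUnion_iUnion_eq_left]
      refine few_boundedSeqs (injOn_id _) ?_
      have hm : max (max β.card κ) ℵ₀ < lam :=
        max_lt (max_lt (lt_ord.1 hβ) hκl) (hκ.1.trans_lt hκl)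
      refine (hGCH.power_le ((le_max_right _ _).trans (Order.le_succ _)) (hlim _ hm).le
        (Order.lt_succ_iff.2 ((le_max_left _ _).trans (le_max_left _ _)))
        (Order.lt_succ_iff.2 ?_)).trans_lt (hlim _ hm)
      exact (lt_ord.1 hi).le.trans ((le_max_right _ _).trans (le_max_left _ _))
    · intro S hS C hC
      obtain ⟨E, hE, hEm, hEs⟩ := hS.exists_seq hκ hκl hC
      exact ⟨E, fun i j hij hj => hEm _ _ hij hj.le, fun i hi => (hE _ hi.le).2,
        fun i hi => exists_guess hi rfl fun j hj => ⟨hEm _ _ hj hi.le, hEm _ _ hj hi.le⟩,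
        fun i hi hlim => hEs id i hlim fun j hj => ⟨hj.le.trans hi, fun k hk => hk⟩⟩

/-- The ordinals closed under `h` form a club. -/
theorem clubIn_closurePoints {lam : Cardinal.{u}} (hreg : lam.IsRegular) (hunc : ℵ₀ < lam)
    {h : Ordinal.{u} → Ordinal.{u}} (hh : ∀ β < lam.ord, h β < lam.ord) :
    ClubIn {α | α < lam.ord ∧ ∀ β < α, h β < α} lam.ord := by
  refine ⟨fun α h => h.1, fun ξ hξ => ?_, fun δ hδ h0 hlim => ⟨hδ, fun β hβ => ?_⟩⟩
  · have hlim := isSuccLimit_ord hreg.1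
    have hsup : ∀ x < lam.ord, ∃ b < lam.ord, x < b ∧ ∀ β < x, h β < b := by
      intro x hx
      obtain ⟨b, hb, hb'⟩ := Few.exists_bound hreg (few_Iio (lt_ord.1 hx)) h
        fun β hβ => hh β (lt_trans hβ hx)
      exact ⟨max b (x + 1), max_lt hb (hlim.succ_lt hx),
        lt_max_of_lt_right (Order.lt_add_one_iff.2 le_rfl), fun β hβ => lt_max_of_lt_left (hb' β hβ)⟩
    choose! b hb hxb hbb using hsup
    -- The supremum of the ω iterates is a closure point, below `lam` by uncountable cofinality.
    have hn : ∀ n : ℕ, b^[n] (ξ + 1) < lam.ord := by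
      intro n
      induction n with
      | zero => exact hlim.succ_lt hξ
      | succ n ih => rw [Function.iterate_succ_apply']; exact hb _ ih
    obtain ⟨s, hs, hs'⟩ : ∃ s < lam.ord, IsLUB (range fun n : ℕ => b^[n] (ξ + 1)) s := by
      refine ⟨_, ?_, isLUB_ciSup Ordinal.bddAbove_of_small⟩
      refine Ordinal.lift_iSup_lt_of_lt_cof ?_ hn
      simpa [hreg.cof_ord] using hunc
    refine ⟨s, ⟨hs, fun β hβ => ?_⟩, ?_⟩
    · obtain ⟨_, ⟨n, rfl⟩, hn'⟩ := (lt_isLUB_iff hs').1 hβ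
      refine (hbb _ (hn n) β hn').trans_le (hs'.1 ⟨n + 1, ?_⟩)
      exact Function.iterate_succ_apply' _ _ _
    · exact lt_of_lt_of_le (Order.lt_add_one_iff.2 le_rfl) (hs'.1 ⟨0, rfl⟩)
  · obtain ⟨η, hη, h1, h2⟩ := hlim β hβ
    exact (hη.2 β h1).trans h2

/-! ### Construction of sparse sequences -/

namespace ExplicitName

variable {P : Type u} [Preorder P] {lam : Cardinal.{u}} (σ : ExplicitName P lam)

/-- The length of the string of a condition in the domain. -/
def lh (p : σ.dom) : Ordinal.{u} := (σ.str p).length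

open Classical in
/-- The sequence of conditions obtained from `start` by applying `step` at successors and the
partial function `cb` at limits, with the parameters `a`. -/
noncomputable def run (cb : TSeq σ.dom →. σ.dom) (start : σ.dom)
    (step : Ordinal.{u} → σ.dom → Ordinal.{u} → σ.dom) (a : Ordinal.{u} → Ordinal.{u})
    (i : Ordinal.{u}) : σ.dom :=
  -- The target length handed to `step` is at least `a i` and exceeds the current length. At limits
  -- `start` is a default for undefined `cb`.
  Ordinal.limitRecOn i start (fun i p => step i p (max (a i) (σ.lh p + 1)))
    fun o _ r => (cb ⟨o, fun j => r j.1 j.2⟩).getOrElse start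

variable {σ} {cb : TSeq σ.dom →. σ.dom} {start : σ.dom}
  {step : Ordinal.{u} → σ.dom → Ordinal.{u} → σ.dom} {a b : Ordinal.{u} → Ordinal.{u}}

theorem run_zero : σ.run cb start step a 0 = start := Ordinal.limitRecOn_zero ..

theorem run_add_one (i : Ordinal.{u}) : σ.run cb start step a (i + 1) =
    step i (σ.run cb start step a i) (max (a i) (σ.lh (σ.run cb start step a i) + 1)) :=
  Ordinal.limitRecOn_add_one ..

open Classical in
theorem run_limit_eq {i : Ordinal.{u}} (hi : Order.IsSuccLimit i) :
    σ.run cb start step a i =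
      (cb ⟨i, fun j => σ.run cb start step a j⟩).getOrElse start :=
  Ordinal.limitRecOn_limit _ _ _ _ hi

open Classical in
theorem run_limit {i : Ordinal.{u}} (hi : Order.IsSuccLimit i)
    (h : (cb ⟨i, fun j => σ.run cb start step a j⟩).Dom) :
    σ.run cb start step a i ∈ cb ⟨i, fun j => σ.run cb start step a j⟩ := by
  rw [run_limit_eq hi, Part.getOrElse_of_dom _ h]
  exact Part.get_mem h

/-- Stage `i` depends only on `a` below `i`, so guessing that initial segment determines the
condition. -/
theorem run_congr {i : Ordinal.{u}} (h : ∀ j < i, a j = b j) :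
    σ.run cb start step a i = σ.run cb start step b i := by
  induction i using Ordinal.limitRecOn with
  | zero => simp only [run_zero]
  | add_one i ih =>
    have hlt : i < i + 1 := Order.lt_add_one_iff.2 le_rfl
    simp only [run_add_one, ih fun j hj => h j (hj.trans hlt), h i hlt]
  | limit i hi ih =>
    have : (fun j : Iio i => σ.run cb start step a j) = fun j : Iio i => σ.run cb start step b j :=
      funext fun j => ih j j.2 fun k hk => h k (hk.trans j.2)
    rw [run_limit_eq hi, run_limit_eq hi, this]

/-- The length of a sequence of conditions whose lengths interleave with `a`. -/
theorem isLUB_interleave {r : Ordinal.{u} → σ.dom} {i δ : Ordinal.{u}} (hi : Order.IsSuccLimit i)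
    (h1 : ∀ j < i, ∀ k < j, σ.lh (r k) < σ.lh (r j))
    (h2 : ∀ j < i, a j ≤ σ.lh (r (j + 1)) ∧ σ.lh (r (j + 1)) < a (j + 1))
    (hδ : IsLUB (a '' Iio i) δ) : IsLUB ((fun j => σ.lh (r j)) '' Iio i) δ := by
  constructor
  · rintro _ ⟨j, hj, rfl⟩
    have hj1 := hi.succ_lt hj
    exact ((h1 _ hj1 j (Order.lt_succ j)).trans (h2 j hj).2).le.trans (hδ.1 ⟨_, hj1, rfl⟩)
  · intro x hx
    refine hδ.2 ?_
    rintro _ ⟨j, hj, rfl⟩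
    exact (h2 j hj).1.trans (hx ⟨_, hi.succ_lt hj, rfl⟩)

theorem length_seqStr_eq {r : Ordinal.{u} → σ.dom} {i δ : Ordinal.{u}} (hi : 0 < i)
    (hδ : IsLUB ((fun j => σ.lh (r j)) '' Iio i) δ) :
    (σ.seqStr ⟨i, fun j => r j⟩).length = δ := by
  have : IsLUB (range fun j : Iio i => σ.lh (r j)) δ := by rwa [image_eq_range] at hδ
  have : Nonempty (Iio i) := ⟨⟨0, hi⟩⟩
  exact (isLUB_ciSup Ordinal.bddAbove_of_small).unique ‹_›

end ExplicitName

open ExplicitName in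
/-- For a regular `κ < lam`, any way of extending conditions can be iterated along a sparse
sequence of length `κ + 1`. -/
theorem SparseName.exists_run {lam : Cardinal.{u}} (hreg : lam.IsRegular) (hunc : ℵ₀ < lam)
    (hGCH : GCHBelow lam) {S : Set Ordinal.{u}} (hS : IsFat lam S) {P : Type u} [Preorder P]
    (σ : SparseName P lam S) {κ : Cardinal.{u}} (hκ : κ.IsRegular) (hκl : κ < lam)
    (Q : Ordinal.{u} → σ.dom → σ.dom → Prop) (start : σ.dom)
    (hstep : ∀ i < κ.ord, ∀ p : σ.dom, start ≤ p → ∀ α < lam.ord,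
      ∃ q, p ≤ q ∧ α ≤ σ.lh q ∧ Q i p q) :
    ∃ r : Ordinal.{u} → σ.dom, r 0 = start ∧
      (∀ i ≤ κ.ord, ∀ j < i, r j ≤ r i ∧ σ.lh (r j) < σ.lh (r i)) ∧
      (∀ i < κ.ord, Q i (r i) (r (i + 1))) ∧
      ∀ i ≤ κ.ord, Order.IsSuccLimit i → ∃ δ ∈ S, IsLUB ((fun j => σ.lh (r j)) '' Iio i) δ ∧
        σ.lh (r i) = δ + 1 ∧ δ ∉ (σ.str (r i)).ones := by
  classical
  have hlim := isSuccLimit_ord hreg.1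
  have hκlim := isSuccLimit_ord hκ.1
  have hstep' : ∀ i p α, ∃ q : σ.dom, i < κ.ord → start ≤ p → α < lam.ord →
      p ≤ q ∧ α ≤ σ.lh q ∧ Q i p q := by
    intro i p α
    by_cases h : i < κ.ord ∧ start ≤ p ∧ α < lam.ord
    · obtain ⟨q, hq⟩ := hstep i h.1 p h.2.1 α h.2.2
      exact ⟨q, fun _ _ _ => hq⟩
    · exact ⟨p, fun h1 h2 h3 => absurd ⟨h1, h2, h3⟩ h⟩
  choose step hstep using hstep'
  obtain ⟨F, hF, hFS⟩ := exists_guessing_family hreg hGCH hκ hκl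
  -- A history ending in β is a guess `g` below `i`, updated to β at `i`.
  have hbound : ∀ β < lam.ord, ∃ b < lam.ord, ∀ i < κ.ord, ∀ g ∈ F β,
      σ.lh (σ.run σ.cb start step (Function.update g i β) (i + 1)) < b := by
    intro β hβ
    have : ∀ i < κ.ord, ∃ b < lam.ord, ∀ g ∈ F β,
        σ.lh (σ.run σ.cb start step (Function.update g i β) (i + 1)) < b := fun i _ =>
      Few.exists_bound hreg (hF β hβ) _ fun g _ => σ.length_lt _
    choose! b hb hb' using this
    obtain ⟨b', hb1, hb2⟩ := Few.exists_bound hreg (few_Iio (o := κ.ord) (by simpa using hκl)) b hb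
    exact ⟨b', hb1, fun i hi g hg => (hb' i hi g hg).trans (hb2 i hi)⟩
  choose! h hh hh' using hbound
  obtain ⟨a, ha⟩ := hFS S hS _ (clubIn_closurePoints hreg hunc hh)
  let r : Ordinal.{u} → σ.dom := σ.run σ.cb start step a
  have hal : ∀ i < κ.ord, a i < lam.ord := fun i hi => (ha.mem i hi).1
  -- The actual history is among those bounded by `h (a i)`, and `a (i + 1)` is closed under `h`.
  have hupper : ∀ i < κ.ord, σ.lh (r (i + 1)) < a (i + 1) := by
    intro i hi
    have hi1 := hκlim.succ_lt hi
    obtain ⟨g, hg, hga⟩ := ha.guess i hi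
    have h1 : r (i + 1) = σ.run σ.cb start step (Function.update g i (a i)) (i + 1) := by
      refine run_congr fun j hj => ?_
      rcases (Order.lt_add_one_iff.1 hj).eq_or_lt with rfl | hj
      · simp
      · rw [Function.update_of_ne hj.ne, hga j hj]
    rw [h1]
    exact (hh' _ (hal i hi) i hi g hg).trans
      ((ha.mem _ hi1).2 _ (ha.strictMono _ _ (Order.lt_succ i) hi1))
  have hsucc : ∀ i < κ.ord, start ≤ r i → r i ≤ r (i + 1) ∧
      max (a i) (σ.lh (r i) + 1) ≤ σ.lh (r (i + 1)) ∧ Q i (r i) (r (i + 1)) := by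
    intro i hi hp
    have := hstep i (r i) (max (a i) (σ.lh (r i) + 1)) hi hp
      (max_lt (hal i hi) (hlim.succ_lt (σ.length_lt _)))
    rwa [← run_add_one (cb := σ.cb) (start := start) (step := step)] at this
  have hmain : ∀ i ≤ κ.ord, start ≤ r i ∧ (∀ j < i, r j ≤ r i ∧ σ.lh (r j) < σ.lh (r i)) ∧
      (Order.IsSuccLimit i → r i ∈ σ.cb ⟨i, fun j => r j⟩ ∧
        ∃ δ ∈ S, IsLUB ((fun j => σ.lh (r j)) '' Iio i) δ ∧
        σ.lh (r i) = δ + 1 ∧ δ ∉ (σ.str (r i)).ones) := by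
    intro i
    induction i using WellFoundedLT.induction with
    | _ i ih =>
      intro hi
      rcases Ordinal.zero_or_succ_or_isSuccLimit i with rfl | ⟨k, rfl⟩ | hlimi
      · refine ⟨(run_zero (σ := σ.toExplicitName)).ge, fun j hj => absurd hj not_lt_zero, fun h => ?_⟩
        exact absurd h Ordinal.not_isSuccLimit_zero
      · have hk : k < Order.succ k := Order.lt_succ k
        have hkκ := hk.trans_le hi
        obtain ⟨i1, i2, -⟩ := ih k hk hkκ.le
        obtain ⟨s1, s2, -⟩ := hsucc k hkκ i1
        have s3 : σ.lh (r k) < σ.lh (r (k + 1)) :=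
          Order.add_one_le_iff.1 ((le_max_right _ _).trans s2)
        refine ⟨i1.trans s1, fun j hj => ?_, fun h => absurd h (Order.not_isSuccLimit_succ k)⟩
        rcases (Order.lt_succ_iff.1 hj).eq_or_lt with rfl | hj
        · exact ⟨s1, s3⟩
        · exact ⟨(i2 j hj).1.trans s1, (i2 j hj).2.trans s3⟩
      · have hsparse : σ.IsSparseSeq σ.cb ⟨i, fun j => r j⟩ :=
          { len_lt := hi.trans_lt (ord_lt_ord.2 hκl)
            increasing := fun j k hjk => ((ih k k.2 (k.2.le.trans hi)).2.1 j hjk).1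
            length_lt := fun j k hjk => ((ih k k.2 (k.2.le.trans hi)).2.1 j hjk).2
            limit := fun k hk => ((ih k k.2 (k.2.le.trans hi)).2.2 hk).1 }
        obtain ⟨δ, hδS, hδ⟩ := ha.limit i hi hlimi
        have hδ' : IsLUB ((fun j => σ.lh (r j)) '' Iio i) δ := by
          refine isLUB_interleave hlimi (fun j hj k hk => ((ih j hj (hj.le.trans hi)).2.1 k hk).2)
            (fun j hj => ⟨?_, hupper j (hj.trans_le hi)⟩) hδ
          exact (le_max_left _ _).trans
            (hsucc j (hj.trans_le hi) (ih j hj (hj.le.trans hi)).1).2.1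
        have hlen := length_seqStr_eq (σ := σ.toExplicitName) hlimi.bot_lt hδ'
        have hdom := σ.defined ⟨i, fun j => r j⟩ hsparse hlimi (by rw [hlen]; exact hδS)
        have hmem : r i ∈ σ.cb ⟨i, fun j => r j⟩ := run_limit hlimi hdom
        obtain ⟨-, -, hub, hstr⟩ := σ.isChoice _ _ hmem
        have hlh : σ.lh (r i) = δ + 1 := by
          rw [lh, hstr, ← hlen]
          rfl
        refine ⟨?_, fun j hj => ⟨hub ⟨j, hj⟩, ?_⟩, fun _ => ⟨hmem, δ, hδS, hδ', hlh, ?_⟩⟩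
        · exact (ih 0 hlimi.bot_lt zero_le).1.trans (hub ⟨0, hlimi.bot_lt⟩)
        · rw [hlh]
          exact Order.lt_add_one_iff.2 (hδ'.1 ⟨j, hj, rfl⟩)
        -- The union of the earlier strings has length δ, so the digit at δ is the appended 0.
        · intro hmem'
          rw [hstr] at hmem'
          exact absurd ((σ.seqStr ⟨i, fun j => r j⟩).ones_subset hmem') (by simp [hlen])
  exact ⟨r, run_zero, fun i hi => (hmain i hi).2.1, fun i hi => (hsucc i hi (hmain i hi.le).1).2.2,
    fun i hi hl => ((hmain i hi).2.2 hl).2⟩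

/-! ### Distributivity -/

open ExplicitName in
-- An injection of the index set into κ schedules at most one dense open set per stage; the last
-- condition of the run lies in all of them.
theorem SparseName.denseOpen_iInter_of_mk_le {lam : Cardinal.{u}} (hreg : lam.IsRegular)
    (hunc : ℵ₀ < lam) (hGCH : GCHBelow lam) {S : Set Ordinal.{u}} (hS : IsFat lam S) {P : Type u}
    [Preorder P] (σ : SparseName P lam S) {κ : Cardinal.{u}} (hκ : κ.IsRegular) (hκl : κ < lam)
    {ι : Type u} (hι : #ι ≤ κ) {U : ι → Set P} (hU : ∀ i, DenseOpen (U i)) :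
    DenseOpen (⋂ i, U i) := by
  refine ⟨fun p => ?_, fun p hp q hpq => mem_iInter.2 fun i =>
    (hU i).isOpen p (mem_iInter.1 hp i) q hpq⟩
  rw [← mk_ord_toType κ] at hι
  obtain ⟨f⟩ := hι
  obtain ⟨start, hstart, -⟩ := σ.dense 0 hreg.ord_pos p
  obtain ⟨r, h0, hr, hQ, -⟩ := σ.exists_run hreg hunc hGCH hS hκ hκl
    (fun i _ q => ∀ x, (f x : Ordinal) = i → (q : P) ∈ U x) start (by
      intro i hi p _ α hα
      by_cases h : ∃ x, (f x : Ordinal) = i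
      · obtain ⟨x, hx⟩ := h
        obtain ⟨q, hpq, hq⟩ := (hU x).dense p
        obtain ⟨q', hqq', hq'⟩ := σ.dense α hα q
        refine ⟨q', hpq.trans hqq', hq', fun y hy => ?_⟩
        have : y = x := f.injective (Ordinal.ToType.mk.symm.injective (Subtype.ext (hy.trans hx.symm)))
        rw [this]
        exact (hU x).isOpen q hq q' hqq'
      · obtain ⟨q, hpq, hq⟩ := σ.dense α hα p
        exact ⟨q, hpq, hq, fun y hy => absurd ⟨y, hy⟩ h⟩)
  have hlim := isSuccLimit_ord hκ.1
  refine ⟨r κ.ord, hstart.trans ?_, mem_iInter.2 fun x => ?_⟩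
  · rw [← h0]
    exact (hr _ le_rfl 0 hlim.bot_lt).1
  · have hx : (f x : Ordinal) < κ.ord := (Ordinal.ToType.mk.symm (f x)).2
    exact (hU x).isOpen _ (hQ _ hx x rfl) _ (hr _ le_rfl _ (hlim.succ_lt hx)).1

/-- Induction on the number of sets. A singular number is cut into initial segments along a cofinal
set, both kinds of intersection being shorter. -/
theorem SparseName.isDistributive {lam : Cardinal.{u}} (hreg : lam.IsRegular)
    (hunc : ℵ₀ < lam) (hGCH : GCHBelow lam) {S : Set Ordinal.{u}} (hS : IsFat lam S) {P : Type u}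
    [Preorder P] (σ : SparseName P lam S) : IsDistributive P lam := by
  suffices ∀ c : Cardinal.{u}, c < lam → ∀ ι : Type u, #ι = c → ∀ U : ι → Set P,
      (∀ i, DenseOpen (U i)) → DenseOpen (⋂ i, U i) from fun ι hι U hU => this _ hι ι rfl U hU
  intro c
  induction c using WellFoundedLT.induction with
  | _ c ih =>
    intro hc ι hι U hU
    rcases lt_aleph0_or_isRegular_or_isSingular (c := c) with h | h | h
    · exact σ.denseOpen_iInter_of_mk_le hreg hunc hGCH hS isRegular_aleph0 hunc (hι.trans_lt h).le hU
    · exact σ.denseOpen_iInter_of_mk_le hreg hunc hGCH hS h hc hι.le hU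
    · obtain ⟨e⟩ : Nonempty (c.ord.ToType ≃ ι) := Cardinal.eq.1 (by simp [hι])
      have hc0 : ℵ₀ ≤ c := h.1
      have := noMaxOrder hc0
      obtain ⟨s, hs, hsc⟩ := Order.exists_cof_eq c.ord.ToType
      have hsplit : ⋂ i, U i = ⋂ k : s, ⋂ x : Iio k.1, U (e x) := by
        ext p
        simp only [mem_iInter]
        refine ⟨fun hp k x => hp _, fun hp i => ?_⟩
        obtain ⟨y, hy⟩ := exists_gt (e.symm i)
        obtain ⟨k, hk, hyk⟩ := hs y
        simpa using hp ⟨k, hk⟩ ⟨e.symm i, hy.trans_le hyk⟩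
      rw [hsplit]
      have hcof : #s < c := by
        rw [hsc, Ordinal.cof_toType]
        exact h.cof_ord_lt
      refine ih _ hcof (hcof.trans hc) _ rfl _ fun k => ?_
      have hk : #(Iio k.1) < c := by simpa using mk_Iio_lt k.1 (by simp)
      exact ih _ hk (hk.trans hc) _ rfl _ fun x => hU _

/-! ### The forcing relation for equality and membership -/

namespace PName

variable {P : Type u} [Preorder P] {x y z x' y' A B : PName P} {p q : P}

/-- `z` is an element of the set of pairs `A`, with a condition weaker than `s`. -/
def HasElt : PName P → PName P → P → Prop
  | mk _ a c, z, s => ∃ i, z = a i ∧ ∃ r ∈ c i, r ≤ s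

theorem HasElt.mono (h : HasElt A z p) (hpq : p ≤ q) : HasElt A z q := by
  cases A
  obtain ⟨i, hi, r, hr, hrp⟩ := h
  exact ⟨i, hi, r, hr, hrp.trans hpq⟩

/-- Frees later arguments from index types. The two nested extensions in `eq` merge because `HasElt`
persists to stronger conditions. -/
theorem eq_iff : eq x y p ↔
    (∀ z q, p ≤ q → HasElt x z q → ∃ s, q ≤ s ∧ ∃ w, HasElt y w s ∧ eq z w s) ∧
    (∀ w q, p ≤ q → HasElt y w q → ∃ s, q ≤ s ∧ ∃ z, HasElt x z s ∧ eq z w s) := by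
  cases x with | mk ι a c =>
  cases y with | mk κ b d =>
  rw [eq]
  refine and_congr ⟨?_, ?_⟩ ⟨?_, ?_⟩
  · rintro h z q hpq ⟨i, rfl, hi⟩
    obtain ⟨s, hs, j, hj, he⟩ := h i q hpq hi q le_rfl
    exact ⟨s, hs, _, ⟨j, rfl, hj⟩, he⟩
  · rintro h i q hpq ⟨r, hr, hrq⟩ q' hq'
    obtain ⟨s, hs, w, ⟨j, rfl, hj⟩, he⟩ := h _ q' (hpq.trans hq') ⟨i, rfl, r, hr, hrq.trans hq'⟩
    exact ⟨s, hs, j, hj, he⟩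
  · rintro h z q hpq ⟨i, rfl, hi⟩
    obtain ⟨s, hs, j, hj, he⟩ := h i q hpq hi q le_rfl
    exact ⟨s, hs, _, ⟨j, rfl, hj⟩, he⟩
  · rintro h i q hpq ⟨r, hr, hrq⟩ q' hq'
    obtain ⟨s, hs, w, ⟨j, rfl, hj⟩, he⟩ := h _ q' (hpq.trans hq') ⟨i, rfl, r, hr, hrq.trans hq'⟩
    exact ⟨s, hs, j, hj, he⟩

theorem mem_iff : mem x A p ↔ ∀ q, p ≤ q → ∃ s, q ≤ s ∧ ∃ w, HasElt A w s ∧ eq x w s := by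
  cases A with | mk ι a c =>
  rw [mem]
  refine forall₂_congr fun q _ => exists_congr fun s => and_congr_right fun _ => ⟨?_, ?_⟩
  · rintro ⟨j, hj, he⟩
    exact ⟨_, ⟨j, rfl, hj⟩, he⟩
  · rintro ⟨_, ⟨j, rfl, hj⟩, he⟩
    exact ⟨j, hj, he⟩

theorem eq.mono (h : eq x y p) (hpq : p ≤ q) : eq x y q := by
  rw [eq_iff] at h ⊢
  exact ⟨fun z r hr => h.1 z r (hpq.trans hr), fun z r hr => h.2 z r (hpq.trans hr)⟩

theorem mem.mono (h : mem x A p) (hpq : p ≤ q) : mem x A q := by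
  rw [mem_iff] at h ⊢
  exact fun r hr => h r (hpq.trans hr)

theorem eq_of_dense (h : ∀ q, p ≤ q → ∃ s, q ≤ s ∧ eq x y s) : eq x y p := by
  rw [eq_iff]
  constructor
  · intro z q hpq hz
    obtain ⟨s, hqs, hs⟩ := h q hpq
    obtain ⟨t, hst, w, hw⟩ := (eq_iff.1 hs).1 z s le_rfl (hz.mono hqs)
    exact ⟨t, hqs.trans hst, w, hw⟩
  · intro z q hpq hz
    obtain ⟨s, hqs, hs⟩ := h q hpq
    obtain ⟨t, hst, w, hw⟩ := (eq_iff.1 hs).2 z s le_rfl (hz.mono hqs)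
    exact ⟨t, hqs.trans hst, w, hw⟩

theorem mem_of_dense (h : ∀ q, p ≤ q → ∃ s, q ≤ s ∧ mem x A s) : mem x A p := by
  rw [mem_iff]
  intro q hpq
  obtain ⟨s, hqs, hs⟩ := h q hpq
  obtain ⟨t, hst, w, hw⟩ := mem_iff.1 hs s le_rfl
  exact ⟨t, hqs.trans hst, w, hw⟩

theorem eq.refl (x : PName P) (p : P) : eq x x p := by
  induction x generalizing p with
  | mk ι a c ih =>
    rw [eq_iff]
    constructor
    all_goals
      rintro z q _ ⟨i, rfl, hi⟩
      exact ⟨q, le_rfl, a i, ⟨i, rfl, hi⟩, ih i q⟩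

theorem eq.symm (h : eq x y p) : eq y x p := by
  induction x generalizing y p with
  | mk ι a c ih =>
    rw [eq_iff] at h ⊢
    constructor
    · intro z q hq hz
      obtain ⟨s, hs, _, ⟨i, rfl, hi⟩, he⟩ := h.2 z q hq hz
      exact ⟨s, hs, _, ⟨i, rfl, hi⟩, ih i he⟩
    · rintro _ q hq ⟨i, rfl, hi⟩
      obtain ⟨s, hs, w, hw, he⟩ := h.1 _ q hq ⟨i, rfl, hi⟩
      exact ⟨s, hs, w, hw, ih i he⟩

theorem eq.trans (h : eq x y p) (h' : eq y z p) : eq x z p := by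
  induction x generalizing y z p with
  | mk ι a c ih =>
    rw [eq_iff] at h h' ⊢
    constructor
    · rintro _ q hq ⟨i, rfl, hi⟩
      obtain ⟨s, hs, w, hw, he⟩ := h.1 _ q hq ⟨i, rfl, hi⟩
      obtain ⟨t, ht, v, hv, he'⟩ := h'.1 w s (hq.trans hs) hw
      exact ⟨t, hs.trans ht, v, hv, ih i (he.mono ht) he'⟩
    · intro v q hq hv
      obtain ⟨s, hs, w, hw, he⟩ := h'.2 v q hq hv
      obtain ⟨t, ht, _, ⟨i, rfl, hi⟩, he'⟩ := h.2 w s (hq.trans hs) hw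
      exact ⟨t, hs.trans ht, _, ⟨i, rfl, hi⟩, ih i he' (he.mono ht)⟩

theorem mem.congr_left (h : mem x A p) (he : eq x y p) : mem y A p := by
  rw [mem_iff] at h ⊢
  intro q hq
  obtain ⟨s, hs, w, hw, hxw⟩ := h q hq
  exact ⟨s, hs, w, hw, (he.mono (hq.trans hs)).symm.trans hxw⟩

theorem mem.congr_right (h : mem x A p) (he : eq A B p) : mem x B p := by
  rw [mem_iff] at h ⊢
  intro q hq
  obtain ⟨s, hs, w, hw, hxw⟩ := h q hq
  obtain ⟨t, ht, v, hv, hwv⟩ := (eq_iff.1 he).1 w s (hq.trans hs) hw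
  exact ⟨t, hs.trans ht, v, hv, (hxw.mono ht).trans hwv⟩

theorem mem_of_hasElt (h : HasElt A x p) : mem x A p :=
  mem_iff.2 fun q hq => ⟨q, le_rfl, x, h.mono hq, eq.refl x q⟩

theorem hasElt_mk_univ {ι : Type u} {a : ι → PName P} :
    HasElt (mk ι a fun _ => univ) z p ↔ ∃ i, z = a i :=
  exists_congr fun _ => and_iff_left ⟨p, trivial, le_rfl⟩

theorem eq_check_iff {a b : PSet.{u}} : eq (check a) (check b) p ↔ a.Equiv b := by
  induction a generalizing b p with
  | mk α a ih =>
    cases b with | mk β b =>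
    rw [eq_iff, PSet.equiv_iff]
    simp only [check, hasElt_mk_univ, PSet.Func]
    constructor
    · rintro ⟨h1, h2⟩
      constructor
      · intro i
        obtain ⟨s, hs, _, ⟨j, rfl⟩, hj⟩ := h1 _ p le_rfl ⟨i, rfl⟩
        exact ⟨j, (ih i).1 hj⟩
      · intro j
        obtain ⟨s, hs, _, ⟨i, rfl⟩, hi⟩ := h2 _ p le_rfl ⟨j, rfl⟩
        exact ⟨i, (ih i).1 hi⟩
    · rintro ⟨h1, h2⟩
      constructor
      · rintro _ q - ⟨i, rfl⟩
        obtain ⟨j, hj⟩ := h1 i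
        exact ⟨q, le_rfl, _, ⟨j, rfl⟩, (ih i).2 hj⟩
      · rintro _ q - ⟨j, rfl⟩
        obtain ⟨i, hi⟩ := h2 j
        exact ⟨q, le_rfl, _, ⟨i, rfl⟩, (ih i).2 hi⟩

/-! ### Names for ordinals and for ground model sets and functions -/

/-- The canonical name of an ordinal. -/
noncomputable def ord (α : Ordinal.{u}) : PName P := check α.toPSet

theorem eq_ord_iff {α β : Ordinal.{u}} : eq (ord α) (ord β : PName P) p ↔ α = β := by
  rw [ord, ord, eq_check_iff, ← ZFSet.eq, Ordinal.mk_toPSet, Ordinal.mk_toPSet,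
    Ordinal.toZFSet_injective.eq_iff]

/-- `p` forces that the elements of `A` are the ordinals in `T`. -/
def OrdRep (A : PName P) (T : Set Ordinal.{u}) (p : P) : Prop :=
  ∀ q, p ≤ q → ∀ x, mem x A q ↔ ∀ q', q ≤ q' → ∃ s, q' ≤ s ∧ ∃ α ∈ T, eq x (ord α) s

variable {T : Set Ordinal.{u}}

theorem OrdRep.mono (h : OrdRep A T p) (hpq : p ≤ q) : OrdRep A T q :=
  fun r hr => h r (hpq.trans hr)

theorem OrdRep.congr (h : OrdRep A T p) (he : eq A B p) : OrdRep B T p := fun q hq x => by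
  rw [← h q hq]
  exact ⟨fun hx => hx.congr_right (he.mono hq).symm, fun hx => hx.congr_right (he.mono hq)⟩

theorem ordRep_mk {ι : Type u} (f : ι → Ordinal.{u}) (hT : range f = T) :
    OrdRep (mk ι (fun i => ord (f i)) fun _ => univ) T p := by
  subst hT
  intro q _ x
  simp only [mem_iff, hasElt_mk_univ, exists_range_iff]
  refine forall₂_congr fun q _ => exists_congr fun s => and_congr_right fun _ => ⟨?_, ?_⟩
  · rintro ⟨_, ⟨i, rfl⟩, hi⟩
    exact ⟨i, hi⟩
  · rintro ⟨i, hi⟩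
    exact ⟨_, ⟨i, rfl⟩, hi⟩

theorem ordRep_ord (o : Ordinal.{u}) : OrdRep (ord o) (Iio o) p := by
  have h1 : (ord o : PName P) = mk o.ToType (fun i => ord (i : Ordinal)) fun _ => univ := by
    rw [ord, Ordinal.toPSet]
    rfl
  have h2 : Iio o = range fun i : o.ToType => (i : Ordinal) := by
    ext α
    constructor
    · intro h
      exact ⟨Ordinal.ToType.mk ⟨α, h⟩, by simp⟩
    · rintro ⟨i, rfl⟩
      exact (Ordinal.ToType.mk.symm i).2
  rw [h1]
  exact ordRep_mk _ h2.symm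

theorem OrdRep.decide (h : OrdRep A T p) (hpq : p ≤ q) (hx : mem x A q) :
    ∃ s, q ≤ s ∧ ∃ α ∈ T, eq x (ord α) s :=
  (h q hpq x).1 hx q le_rfl

theorem OrdRep.mem_ord (h : OrdRep A T p) {α : Ordinal.{u}} (hα : α ∈ T) : mem (ord α) A p :=
  (h p le_rfl _).2 fun q' _ => ⟨q', le_rfl, α, hα, eq.refl _ _⟩

theorem OrdRep.of_mem_ord (h : OrdRep A T p) {α : Ordinal.{u}} (hα : mem (ord α) A p) :
    α ∈ T := by
  obtain ⟨s, -, β, hβ, he⟩ := h.decide le_rfl hα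
  rwa [eq_ord_iff.1 he]

theorem mem_ord_iff {α β : Ordinal.{u}} : mem (ord α) (ord β : PName P) p ↔ α < β :=
  ⟨fun h => (ordRep_ord β).of_mem_ord h, fun h => (ordRep_ord β).mem_ord h⟩

theorem hasElt_succ : HasElt (succ A) z p ↔ z = A ∨ HasElt A z p := by
  cases A with | mk ι a c =>
  constructor
  · rintro ⟨_ | i, rfl, hi⟩
    · exact Or.inl rfl
    · exact Or.inr ⟨i, rfl, hi⟩
  · rintro (rfl | ⟨i, rfl, hi⟩)
    · exact ⟨none, rfl, p, trivial, le_rfl⟩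
    · exact ⟨some i, rfl, hi⟩

/-- `A` is only forced to equal θ, so `succ A` need not be a canonical name. -/
theorem ordRep_succ {θ : Ordinal.{u}} (h : eq A (ord θ) p) :
    OrdRep (succ A) (Iio (θ + 1)) p := by
  have hA : OrdRep A (Iio θ) p := (ordRep_ord θ).congr h.symm
  intro q hq x
  constructor
  · intro hx q' hq'
    obtain ⟨s, hs, w, hw, he⟩ := mem_iff.1 hx q' hq'
    have hps := hq.trans (hq'.trans hs)
    rcases hasElt_succ.1 hw with rfl | hw
    · exact ⟨s, hs, θ, mem_Iio.2 (Order.lt_add_one_iff.2 le_rfl), he.trans (h.mono hps)⟩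
    · obtain ⟨t, ht, α, hα, he'⟩ := hA.decide hps (mem_of_hasElt hw)
      exact ⟨t, hs.trans ht, α, mem_Iio.2 (Order.lt_add_one_iff.2 (le_of_lt hα)), (he.mono ht).trans he'⟩
  · intro hx
    refine mem_iff.2 fun q' hq' => ?_
    obtain ⟨s, hs, α, hα, he⟩ := hx q' hq'
    have hps := hq.trans (hq'.trans hs)
    rcases (Order.lt_add_one_iff.1 (mem_Iio.1 hα)).eq_or_lt with rfl | hα
    · exact ⟨s, hs, A, hasElt_succ.2 (Or.inl rfl), he.trans (h.mono hps).symm⟩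
    · have h1 : mem x A s := ((hA.mono hps).mem_ord hα).congr_left he.symm
      obtain ⟨t, ht, w, hw, he'⟩ := mem_iff.1 h1 s le_rfl
      exact ⟨t, hs.trans ht, w, hasElt_succ.2 (Or.inr hw), he'⟩

theorem upair_congr (h : eq x x' p) (h' : eq y y' p) : eq (upair x y) (upair x' y') p := by
  rw [eq_iff]
  simp only [upair, hasElt_mk_univ]
  constructor
  · rintro _ q hq ⟨⟨b⟩, rfl⟩
    refine ⟨q, le_rfl, _, ⟨⟨b⟩, rfl⟩, ?_⟩
    cases b
    · exact h'.mono hq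
    · exact h.mono hq
  · rintro _ q hq ⟨⟨b⟩, rfl⟩
    refine ⟨q, le_rfl, _, ⟨⟨b⟩, rfl⟩, ?_⟩
    cases b
    · exact h'.mono hq
    · exact h.mono hq

theorem pair_congr (h : eq x x' p) (h' : eq y y' p) : eq (pair x y) (pair x' y') p :=
  upair_congr (upair_congr h h) (upair_congr h h')

/-- Pairs of canonical names are again canonical names, which reduces injectivity of pairing to the
ground model. -/
theorem upair_check_eq {P : Type u} (a b : PSet.{u}) :
    ∃ c : PSet.{u}, upair (check a) (check b) = check (P := P) c ∧
      ZFSet.mk c = {ZFSet.mk a, ZFSet.mk b} := by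
  refine ⟨PSet.mk (ULift Bool) fun i => if i.down then a else b, ?_, ?_⟩
  · simp only [upair, check, apply_ite]
  · ext z
    induction z using Quotient.inductionOn with | _ z =>
    change ZFSet.mk z ∈ _ ↔ ZFSet.mk z ∈ _
    rw [ZFSet.mk_mem_iff, ZFSet.mem_pair, ZFSet.eq, ZFSet.eq]
    constructor
    · rintro ⟨⟨_ | _⟩, h⟩
      · exact Or.inr h
      · exact Or.inl h
    · rintro (h | h)
      · exact ⟨⟨true⟩, h⟩
      · exact ⟨⟨false⟩, h⟩

theorem pair_ord_inj {α β α' β' : Ordinal.{u}}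
    (h : eq (pair (ord α) (ord β)) (pair (ord α') (ord β') : PName P) p) : α = α' ∧ β = β' := by
  have key : ∀ α β : Ordinal.{u}, ∃ c : PSet.{u}, pair (ord α) (ord β) = check (P := P) c ∧
      ZFSet.mk c = ZFSet.pair α.toZFSet β.toZFSet := by
    intro α β
    obtain ⟨c1, h1, h1'⟩ := upair_check_eq (P := P) α.toPSet α.toPSet
    obtain ⟨c2, h2, h2'⟩ := upair_check_eq (P := P) α.toPSet β.toPSet
    obtain ⟨c, hc, hc'⟩ := upair_check_eq (P := P) c1 c2
    refine ⟨c, by rw [pair, ord, ord, h1, h2, hc], ?_⟩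
    rw [hc', h1', h2', ZFSet.pair, Ordinal.mk_toPSet, Ordinal.mk_toPSet]
    simp
  obtain ⟨c, hc, hc'⟩ := key α β
  obtain ⟨d, hd, hd'⟩ := key α' β'
  rw [hc, hd, eq_check_iff, ← ZFSet.eq, hc', hd', ZFSet.pair_inj] at h
  exact ⟨Ordinal.toZFSet_injective h.1, Ordinal.toZFSet_injective h.2⟩

/-- A name for the restriction of the ground model function `E` to the ordinal `o`. -/
noncomputable def graph (o : Ordinal.{u}) (E : Ordinal.{u} → Ordinal.{u}) : PName P :=
  mk o.ToType (fun i => pair (ord i) (ord (E i))) fun _ => univ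

variable {o : Ordinal.{u}} {E : Ordinal.{u} → Ordinal.{u}}

theorem mem_graph_iff {α β : Ordinal.{u}} (hx : eq x (ord α) p) (hy : eq y (ord β) p) :
    mem (pair x y) (graph o E) p ↔ α < o ∧ E α = β := by
  have hxy := pair_congr hx hy
  constructor
  · intro h
    obtain ⟨s, hs, w, hw, he⟩ := mem_iff.1 h p le_rfl
    obtain ⟨i, rfl⟩ := hasElt_mk_univ.1 hw
    obtain ⟨rfl, rfl⟩ := pair_ord_inj ((hxy.mono hs).symm.trans he)
    exact ⟨(Ordinal.ToType.mk.symm i).2, rfl⟩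
  · rintro ⟨hα, rfl⟩
    refine (mem_of_hasElt (hasElt_mk_univ.2 ⟨Ordinal.ToType.mk ⟨α, hα⟩, ?_⟩)).congr_left hxy.symm
    simp

/-- Densely often the arguments and values are decided as ordinals, where `mem_graph_iff` computes
the graph. -/
theorem isFun_graph (hA : OrdRep A (Iio o) p) (hB : OrdRep B T p) (hE : ∀ i < o, E i ∈ T) :
    isFun (graph o E) A B p := by
  refine ⟨?_, ?_, ?_⟩
  · intro z q hq hz q' hq'
    obtain ⟨s, hs, w, hw, he⟩ := mem_iff.1 hz q' hq'
    obtain ⟨i, rfl⟩ := hasElt_mk_univ.1 hw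
    have hi : (i : Ordinal) < o := (Ordinal.ToType.mk.symm i).2
    have hps := hq.trans (hq'.trans hs)
    refine ⟨s, hs, ord i, (hA.mono hps).mem_ord hi, fun t ht => ?_⟩
    exact ⟨t, le_rfl, _, (hB.mono (hps.trans ht)).mem_ord (hE i hi), he.mono ht⟩
  · intro x q hq hx q' hq'
    obtain ⟨s, hs, α, hα, he⟩ := (hA q hq x).1 hx q' hq'
    have hps := hq.trans (hq'.trans hs)
    exact ⟨s, hs, _, (hB.mono hps).mem_ord (hE α hα), (mem_graph_iff he (eq.refl _ _)).2 ⟨hα, rfl⟩⟩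
  · intro x q hq hx y q1 hq1 hy y' q2 hq2 hy' q3 hq3 hxy q4 hq4 hxy'
    refine eq_of_dense fun t ht => ?_
    have h2t := hq3.trans (hq4.trans ht)
    obtain ⟨s, hs, α, -, hα⟩ := (hA q hq x).1 hx t (hq1.trans (hq2.trans h2t))
    obtain ⟨s', hs', β, -, hβ⟩ := (hB q1 (hq.trans hq1) y).1 hy s (hq2.trans (h2t.trans hs))
    obtain ⟨s'', hs'', β', -, hβ'⟩ := (hB q2 (hq.trans (hq1.trans hq2)) y').1 hy' s'
      (h2t.trans (hs.trans hs'))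
    have hα' := hα.mono (hs'.trans hs'')
    have hts := hs.trans (hs'.trans hs'')
    have h1 := (mem_graph_iff hα' (hβ.mono hs'')).1 (hxy.mono (hq4.trans (ht.trans hts)))
    have h2 := (mem_graph_iff hα' hβ').1 (hxy'.mono (ht.trans hts))
    refine ⟨s'', hts, (hβ.mono hs'').trans ?_⟩
    rw [← h1.2, h2.2]
    exact hβ'.symm

theorem isOrderIso_graph (hA : OrdRep A (Iio o) p) (hB : OrdRep B (E '' Iio o) p)
    (hE : ∀ i j, i < j → j < o → E i < E j) : isOrderIso (graph o E) A B p := by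
  refine ⟨isFun_graph hA hB fun i hi => ⟨i, hi, rfl⟩, ?_, ?_⟩
  · intro y q hq hy q' hq'
    obtain ⟨s, hs, _, ⟨i, hi, rfl⟩, he⟩ := (hB q hq y).1 hy q' hq'
    exact ⟨s, hs, ord i, (hA.mono (hq.trans (hq'.trans hs))).mem_ord hi,
      (mem_graph_iff (eq.refl _ _) he).2 ⟨hi, rfl⟩⟩
  · intro x q hq hx x' q1 hq1 hx' y q2 hq2 hy y' q3 hq3 hy' q4 hq4 hxy q5 hq5 hxy' q6 hq6 hxx'
    refine mem_of_dense fun t ht => ?_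
    have h5t := hq6.trans ht
    have h4t := hq5.trans h5t
    have h3t := hq4.trans h4t
    have h2t := hq3.trans h3t
    have h1t := hq2.trans h2t
    obtain ⟨s, hs, α, -, hα⟩ := (hA q hq x).1 hx t (hq1.trans h1t)
    obtain ⟨s1, hs1, α', -, hα'⟩ := (hA q1 (hq.trans hq1) x').1 hx' s (h1t.trans hs)
    obtain ⟨s2, hs2, β, -, hβ⟩ := (hB q2 (hq.trans (hq1.trans hq2)) y).1 hy s1
      (h2t.trans (hs.trans hs1))
    obtain ⟨s3, hs3, β', -, hβ'⟩ := (hB q3 (hq.trans (hq1.trans (hq2.trans hq3))) y').1 hy' s2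
      (h3t.trans (hs.trans (hs1.trans hs2)))
    have hts : t ≤ s3 := hs.trans (hs1.trans (hs2.trans hs3))
    replace hα := hα.mono (hs1.trans (hs2.trans hs3))
    replace hα' := hα'.mono (hs2.trans hs3)
    replace hβ := hβ.mono hs3
    have h1 := (mem_graph_iff hα hβ).1 (hxy.mono (h4t.trans hts))
    have h2 := (mem_graph_iff hα' hβ').1 (hxy'.mono (h5t.trans hts))
    have h3 : α < α' := mem_ord_iff.1
      (((hxx'.mono (ht.trans hts)).congr_left hα).congr_right hα')
    refine ⟨s3, hts, ?_⟩
    refine (mem.congr_left ?_ hβ.symm).congr_right hβ'.symm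
    rw [mem_ord_iff, ← h1.2, ← h2.2]
    exact hE _ _ h3 h2.1

end PName

/-! ### Regular cardinals, clubs and closed sets in the extension -/

/-- A nonzero limit ordinal in which every function from a smaller ordinal is bounded is a regular
cardinal. -/
theorem exists_isRegular_of_bounded {θ : Ordinal.{u}} (h0 : θ ≠ 0) (hlim : ∀ α < θ, ∃ β < θ, α < β)
    (hb : ∀ β < θ, ∀ E : Ordinal.{u} → Ordinal.{u}, (∀ α < β, E α < θ) →
      ∃ γ < θ, ∀ α < β, E α < γ) : ∃ κ : Cardinal.{u}, κ.IsRegular ∧ θ = κ.ord := by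
  classical
  have hl : Order.IsSuccLimit θ := by
    rcases Ordinal.zero_or_succ_or_isSuccLimit θ with h | ⟨k, rfl⟩ | h
    · exact absurd h h0
    · obtain ⟨β, hβ, hkβ⟩ := hlim k (Order.lt_succ k)
      exact absurd (Order.lt_succ_iff.1 hβ) (not_le.2 hkβ)
    · exact h
  refine ⟨θ.cof, isRegular_cof hl, ?_⟩
  refine le_antisymm (not_lt.1 fun hlt => ?_) (Ordinal.ord_cof_le θ)
  -- If cof θ < θ, a cofinal set indexed by cof θ is an unbounded function from a smaller ordinal.
  obtain ⟨s, hs, hsc⟩ := Order.exists_cof_eq θ.ToType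
  obtain ⟨e⟩ : Nonempty (θ.cof.ord.ToType ≃ s) := Cardinal.eq.1 (by simp [hsc])
  obtain ⟨γ, hγ, hγ'⟩ := hb _ hlt
    (fun α => if h : α < θ.cof.ord then ((e (Ordinal.ToType.mk ⟨α, h⟩)).1 : Ordinal) else 0)
    fun α hα => by
      simp only [hα, dif_pos]
      exact (Ordinal.ToType.mk.symm _).2
  obtain ⟨k, hk, hγk⟩ := hs (Ordinal.ToType.mk ⟨γ, hγ⟩)
  have h1 : γ ≤ (k : Ordinal) := by
    have := Ordinal.ToType.mk.symm.monotone hγk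
    rw [OrderIso.symm_apply_apply] at this
    exact this
  obtain ⟨z, hz⟩ := e.surjective ⟨k, hk⟩
  obtain ⟨⟨α, hα⟩, rfl⟩ := Ordinal.ToType.mk.surjective z
  have h2 := hγ' α hα
  rw [dif_pos (mem_Iio.1 hα), hz] at h2
  exact absurd h1 (not_le.2 h2)

namespace PName

variable {P : Type u} [Preorder P] {p q : P}

/-- Regularity is downward absolute: a ground model function from a smaller ordinal has a canonical
name, so its forced bound, once decided, bounds it in the ground model. -/
theorem isRegular.exists_eq {x : PName P} {θ : Ordinal.{u}} (h : isRegular x p)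
    (he : eq x (ord θ) p) : ∃ κ : Cardinal.{u}, κ.IsRegular ∧ θ = κ.ord := by
  have hx : OrdRep x (Iio θ) p := (ordRep_ord θ).congr he.symm
  obtain ⟨h1, h2, h3⟩ := h
  refine exists_isRegular_of_bounded ?_ ?_ ?_
  · obtain ⟨s, hs, y, hy⟩ := h1 p le_rfl
    obtain ⟨t, ht, α, hα, -⟩ := hx.decide hs hy
    exact (lt_of_le_of_lt zero_le (mem_Iio.1 hα)).ne'
  · intro α hα
    obtain ⟨s, hs, y, hy, hαy⟩ := h2 (ord α) p le_rfl (hx.mem_ord hα) p le_rfl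
    obtain ⟨t, ht, β, hβ, he'⟩ := hx.decide hs hy
    exact ⟨β, hβ, mem_ord_iff.1 ((hαy.mono ht).congr_right he')⟩
  · intro β hβ E hE
    obtain ⟨s, hs, y, hy, hb⟩ := h3 (ord β) p le_rfl (hx.mem_ord hβ) (graph β E) p le_rfl
      (isFun_graph (ordRep_ord β) hx hE) p le_rfl
    obtain ⟨t, ht, γ, hγ, he'⟩ := hx.decide hs hy
    refine ⟨γ, hγ, fun α hα => ?_⟩
    have := hb (ord α) t ht (mem_ord_iff.2 hα) (ord (E α)) t le_rfl
      ((hx.mono (hs.trans ht)).mem_ord (hE α hα)) t le_rfl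
      ((mem_graph_iff (eq.refl _ _) (eq.refl _ _)).2 ⟨hα, rfl⟩)
    exact mem_ord_iff.1 (this.congr_right he')

theorem isRegular.mono {x : PName P} (h : isRegular x p) (hpq : p ≤ q) : isRegular x q :=
  ⟨fun r hr => h.1 r (hpq.trans hr), fun y r hr => h.2.1 y r (hpq.trans hr),
    fun y r hr => h.2.2 y r (hpq.trans hr)⟩

theorem isClub.mono {C L : PName P} (h : isClub C L p) (hpq : p ≤ q) : isClub C L q :=
  ⟨fun y r hr => h.1 y r (hpq.trans hr), fun y r hr => h.2.1 y r (hpq.trans hr),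
    fun y r hr => h.2.2 y r (hpq.trans hr)⟩

theorem isClub.exists_gt {C : PName P} {l ξ : Ordinal.{u}} (h : isClub C (ord l) p) (hξ : ξ < l) :
    ∃ s, p ≤ s ∧ ∃ c < l, ξ < c ∧ mem (ord c) C s := by
  obtain ⟨s, hs, y, hy, hξy⟩ := h.2.1 (ord ξ) p le_rfl (mem_ord_iff.2 hξ) p le_rfl
  obtain ⟨t, ht, c, hc, he⟩ := (ordRep_ord l).decide le_rfl (h.1 y s hs hy)
  exact ⟨t, hs.trans ht, c, hc, mem_ord_iff.1 ((hξy.mono ht).congr_right he),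
    (hy.mono ht).congr_left he⟩

theorem isClub.limit_mem {C : PName P} {l δ : Ordinal.{u}} (h : isClub C (ord l) p) (hδ : δ < l)
    (h0 : δ ≠ 0) (hlim : ∀ ξ < δ, ∃ c < δ, ξ < c ∧ mem (ord c) C p) : mem (ord δ) C p := by
  refine h.2.2 (ord δ) p le_rfl (mem_ord_iff.2 hδ) p le_rfl ?_ p le_rfl ?_
  · exact fun q _ => ⟨q, le_rfl, ord 0, mem_ord_iff.2 (pos_iff_ne_zero.2 h0)⟩
  · intro x q hq hx q' hq'
    obtain ⟨s, hs, ξ, hξ, he⟩ := (ordRep_ord δ q le_rfl x).1 hx q' hq'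
    obtain ⟨c, hc, hξc, hcC⟩ := hlim ξ hξ
    exact ⟨s, hs, ord c, hcC.mono (hq.trans (hq'.trans hs)),
      (mem_ord_iff.2 hξc).congr_left he.symm, mem_ord_iff.2 hc⟩

theorem closedBelow_of_ordRep {D : PName P} {T : Set Ordinal.{u}} {l : Ordinal.{u}}
    (hD : OrdRep D T p) (hT : ClosedBelow T l) : closedBelow D (ord l) p := by
  intro x q hq hx q1 hq1 hne q2 hq2 hlim
  refine mem_of_dense fun q3 hq3 => ?_
  obtain ⟨s, hs, δ, hδ, he⟩ := (ordRep_ord l q le_rfl x).1 hx q3 (hq1.trans (hq2.trans hq3))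
  have h2s := hq3.trans hs
  have hps := hq.trans (hq1.trans (hq2.trans h2s))
  refine ⟨s, hs, ((hD.mono hps).mem_ord (hT δ hδ ?_ ?_)).congr_left he.symm⟩
  · obtain ⟨t, ht, y, hy⟩ := hne s (hq2.trans h2s)
    obtain ⟨v, hv, α, hα, -⟩ := (ordRep_ord δ).decide le_rfl (hy.congr_right (he.mono ht))
    exact (lt_of_le_of_lt zero_le (mem_Iio.1 hα)).ne'
  · intro ξ hξ
    obtain ⟨t, ht, y, hy, hξy, hyx⟩ := hlim (ord ξ) s h2s
      ((mem_ord_iff.2 hξ).congr_right he.symm) s le_rfl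
    obtain ⟨v, hv, η, hη, he'⟩ := hD.decide (hps.trans ht) hy
    exact ⟨η, hη, mem_ord_iff.1 ((hξy.mono hv).congr_right he'),
      mem_ord_iff.1 (((hyx.mono hv).congr_left he').congr_right (he.mono (ht.trans hv)))⟩

end PName

/-! ### Fatness of the difference -/

namespace ExplicitName

variable {P : Type u} [Preorder P] {lam : Cardinal.{u}} {σ : ExplicitName P lam}

theorem not_mem_W (hreg : lam.IsRegular) {p : σ.dom} {c : Ordinal.{u}} (hc : c < σ.lh p)
    (hcp : c ∉ (σ.str p).ones) : (PName.mem (PName.ord c) σ.W).not (p : P) := by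
  intro q hpq hmem
  obtain ⟨s, hs, w, hw, he⟩ := PName.mem_iff.1 hmem q le_rfl
  obtain ⟨a, rfl, r, ⟨hr, har⟩, hrs⟩ := hw
  obtain rfl := PName.eq_ord_iff.1 he
  -- A common extension in the domain compares the string that puts `c` into W_σ with the one that
  -- has 0 there.
  obtain ⟨t, hst, -⟩ := σ.dense 0 hreg.ord_pos s
  have h1 := σ.mono ⟨r, hr⟩ t (hrs.trans hst)
  have h2 := σ.mono p t (hpq.trans (hs.trans hst))
  have h3 : (a : Ordinal) ∈ (σ.str t).ones := by
    rw [h1.2] at har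
    exact har.1
  refine hcp ?_
  rw [h2.2]
  exact ⟨h3, hc⟩

/-- A limit of lengths of an increasing sequence of conditions which decide elements of a club in
between is forced into the club. -/
theorem limit_mem_club {r : Ordinal.{u} → σ.dom} {C : PName P} {i δ : Ordinal.{u}} {p : P}
    (hC : PName.isClub C (PName.ord lam.ord) p) (hi : Order.IsSuccLimit i)
    (hδ : IsLUB ((fun j => σ.lh (r j)) '' Iio i) δ) (hδl : δ < lam.ord)
    (hr : ∀ j < i, (r j : P) ≤ p)
    (hc : ∀ j < i, ∃ c, σ.lh (r j) ≤ c ∧ c < σ.lh (r (j + 1)) ∧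
      PName.mem (PName.ord c) C (r (j + 1) : P)) : PName.mem (PName.ord δ) C p := by
  refine hC.limit_mem hδl ?_ fun ξ hξ => ?_
  · obtain ⟨c, -, hc, -⟩ := hc 0 hi.bot_lt
    exact ((zero_le.trans_lt hc).trans_le (hδ.1 ⟨_, hi.succ_lt hi.bot_lt, rfl⟩)).ne'
  · obtain ⟨_, ⟨j, hj, rfl⟩, hξj⟩ := (lt_isLUB_iff hδ).1 hξ
    obtain ⟨c, hc1, hc2, hc3⟩ := hc j hj
    exact ⟨c, hc2.trans_le (hδ.1 ⟨_, hi.succ_lt hj, rfl⟩), hξj.trans_le hc1,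
      hc3.mono (hr _ (hi.succ_lt hj))⟩

end ExplicitName

open ExplicitName

variable {lam : Cardinal.{u}} {S : Set Ordinal.{u}} {P : Type u} [Preorder P]

/-- Conditions which put an element of a given club into `S ∖ W_σ` are dense. -/
theorem SparseName.exists_mem_club (hreg : lam.IsRegular) (hunc : ℵ₀ < lam)
    (hGCH : GCHBelow lam) (hS : IsFat lam S) (σ : SparseName P lam S) {C : PName P} {p : P}
    (hC : PName.isClub C (PName.ord lam.ord) p) {α : Ordinal.{u}} (hα : α < lam.ord) :
    ∃ q : σ.dom, p ≤ q ∧ ∃ c ∈ S, α ≤ c ∧ c < σ.lh q ∧ c ∉ (σ.str q).ones ∧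
      PName.mem (PName.ord c) C (q : P) := by
  obtain ⟨start, hstart, hα'⟩ := σ.dense α hα p
  have hlim := isSuccLimit_ord (le_refl ℵ₀)
  -- Each step of this ω-run decides an element of the club between consecutive lengths, so the
  -- limit length δ is forced into the club.
  obtain ⟨r, h0, hr, hQ, hl⟩ := σ.exists_run hreg hunc hGCH hS isRegular_aleph0 hunc
    (fun _ p q => ∃ c, σ.lh p ≤ c ∧ c < σ.lh q ∧ PName.mem (PName.ord c) C (q : P)) start (by
      intro i _ p' hp' β hβ
      obtain ⟨s, hs, c, hc, hpc, hcC⟩ := (hC.mono (hstart.trans hp')).exists_gt (σ.length_lt p')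
      obtain ⟨q, hsq, hq⟩ := σ.dense (max β (c + 1))
        (max_lt hβ ((isSuccLimit_ord hreg.1).succ_lt hc)) s
      exact ⟨q, hs.trans hsq, (le_max_left _ _).trans hq, c, hpc.le,
        Order.add_one_le_iff.1 ((le_max_right _ _).trans hq), hcC.mono hsq⟩)
  obtain ⟨δ, hδS, hδ, hlh, hones⟩ := hl _ le_rfl hlim
  have hpr : p ≤ r (ord ℵ₀) := hstart.trans (h0 ▸ (hr _ le_rfl 0 hlim.bot_lt).1)
  refine ⟨r (ord ℵ₀), hpr, δ, hδS, ?_, ?_, hones, ?_⟩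
  · refine le_trans hα' (hδ.1 ⟨0, hlim.bot_lt, ?_⟩)
    simp only [h0]
    rfl
  · rw [hlh]
    exact Order.lt_add_one_iff.2 le_rfl
  · exact limit_mem_club (hC.mono hpr) hlim hδ (hS.1 hδS)
      (fun j hj => (hr _ le_rfl j hj).1) hQ

/-- The values of a function which is increasing and continuous form a closed set. -/
theorem closedBelow_image {E : Ordinal.{u} → Ordinal.{u}} {o l : Ordinal.{u}}
    (hmono : ∀ i j, i < j → j ≤ o → E i < E j)
    (hcont : ∀ i ≤ o, Order.IsSuccLimit i → ∀ ξ < E i, ∃ j < i, ξ < E j) :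
    ClosedBelow (E '' Iio (o + 1)) l := by
  intro δ _ h0 hlim
  have hex : ∃ i, i ≤ o ∧ δ ≤ E i := by
    by_contra hcon
    push Not at hcon
    obtain ⟨_, ⟨m, hm, rfl⟩, h1, -⟩ := hlim _ (hcon o le_rfl)
    rcases (Order.lt_add_one_iff.1 (mem_Iio.1 hm)).eq_or_lt with rfl | hm
    · exact lt_irrefl _ h1
    · exact lt_asymm h1 (hmono _ _ hm le_rfl)
  -- For the least `i` with δ ≤ E i, strict inequality is impossible: elements below δ have index
  -- below `i`, and these are not cofinal in δ at zero or a successor, nor, by continuity, at a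
  -- limit.
  obtain ⟨i, ⟨hi, hδi⟩, hmin⟩ := exists_minimal_of_wellFoundedLT _ hex
  replace hmin : ∀ j < i, E j < δ := fun j hj => not_le.1 fun h =>
    absurd (hmin ⟨hj.le.trans hi, h⟩ hj.le) (not_le.2 hj)
  have hbelow : ∀ η ∈ E '' Iio (o + 1), η < δ → ∃ j < i, η = E j := by
    rintro _ ⟨j, hj, rfl⟩ hjδ
    refine ⟨j, not_le.1 fun hij => ?_, rfl⟩
    rcases hij.eq_or_lt with rfl | hij
    · exact absurd hjδ (not_lt.2 hδi)
    · exact absurd (hδi.trans_lt (hmono _ _ hij (Order.lt_add_one_iff.1 hj))) (not_lt.2 hjδ.le)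
  rcases hδi.eq_or_lt with rfl | hδi
  · exact ⟨i, mem_Iio.2 (Order.lt_add_one_iff.2 hi), rfl⟩
  · exfalso
    rcases Ordinal.zero_or_succ_or_isSuccLimit i with rfl | ⟨k, rfl⟩ | hl
    · obtain ⟨η, hη, -, hηδ⟩ := hlim 0 (pos_iff_ne_zero.2 h0)
      obtain ⟨j, hj, -⟩ := hbelow η hη hηδ
      exact not_lt_zero hj
    · obtain ⟨η, hη, hkη, hηδ⟩ := hlim _ (hmin k (Order.lt_succ k))
      obtain ⟨j, hj, rfl⟩ := hbelow η hη hηδ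
      rcases (Order.lt_succ_iff.1 hj).eq_or_lt with rfl | hj
      · exact lt_irrefl _ hkη
      · exact lt_asymm hkη (hmono _ _ hj ((Order.le_succ k).trans hi))
    · obtain ⟨j, hj, hδj⟩ := hcont i hi hl δ hδi
      exact lt_asymm hδj (hmin j hj)

/-- Each successor step of a κ-run inserts a new point by `exists_mem_club`; at a limit the place of
the appended 0 is the point, which makes the enumeration continuous. -/
theorem SparseName.exists_closed_seq (hreg : lam.IsRegular) (hunc : ℵ₀ < lam)
    (hGCH : GCHBelow lam) (hS : IsFat lam S) (σ : SparseName P lam S) {κ : Cardinal.{u}}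
    (hκ : κ.IsRegular) (hκl : κ < lam) {C : PName P} {p : P}
    (hC : PName.isClub C (PName.ord lam.ord) p) :
    ∃ q : σ.dom, p ≤ q ∧ ∃ E : Ordinal.{u} → Ordinal.{u},
      (∀ i j, i < j → j ≤ κ.ord → E i < E j) ∧
      ClosedBelow (E '' Iio (κ.ord + 1)) lam.ord ∧
      ∀ i ≤ κ.ord, E i ∈ S ∧ PName.mem (PName.ord (E i)) C (q : P) ∧
        (PName.mem (PName.ord (E i)) σ.W).not (q : P) := by
  have hlim := isSuccLimit_ord hκ.1
  obtain ⟨start, hstart, c₀, hc₀⟩ := σ.exists_mem_club hreg hunc hGCH hS hC hreg.ord_pos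
  obtain ⟨r, h0, hr, hQ, hl⟩ := σ.exists_run hreg hunc hGCH hS hκ hκl
    (fun _ p q => ∃ c ∈ S, σ.lh p ≤ c ∧ c < σ.lh q ∧ c ∉ (σ.str q).ones ∧
      PName.mem (PName.ord c) C (q : P)) start (by
      intro i _ p' hp' β hβ
      obtain ⟨q, hpq, c, hcS, hc1, hc2, hc3⟩ := σ.exists_mem_club hreg hunc hGCH hS
        (hC.mono (hstart.trans hp')) (max_lt hβ (σ.length_lt p'))
      exact ⟨q, hpq, ((le_max_left _ _).trans hc1).trans hc2.le, c, hcS,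
        (le_max_right _ _).trans hc1, hc2, hc3⟩)
  have hpr : ∀ i ≤ κ.ord, p ≤ r i := by
    intro i hi
    rcases (zero_le (a := i)).eq_or_lt with rfl | h
    · rwa [h0]
    · exact hstart.trans (h0 ▸ (hr i hi 0 h).1)
  have key : ∀ i ≤ κ.ord, ∃ c ∈ S, (∀ j < i, σ.lh (r j) ≤ c) ∧ c < σ.lh (r i) ∧
      c ∉ (σ.str (r i)).ones ∧ PName.mem (PName.ord c) C (r i : P) ∧
      (Order.IsSuccLimit i → IsLUB ((fun j => σ.lh (r j)) '' Iio i) c) := by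
    intro i hi
    rcases Ordinal.zero_or_succ_or_isSuccLimit i with rfl | ⟨k, rfl⟩ | hl'
    · rw [h0]
      exact ⟨c₀, hc₀.1, fun j hj => absurd hj not_lt_zero, hc₀.2.2.1, hc₀.2.2.2.1, hc₀.2.2.2.2,
        fun h => absurd h Ordinal.not_isSuccLimit_zero⟩
    · have hk : k < κ.ord := (Order.lt_succ k).trans_le hi
      obtain ⟨c, hcS, hc1, hc2, hc3, hc4⟩ := hQ k hk
      refine ⟨c, hcS, fun j hj => ?_, hc2, hc3, hc4,
        fun h => absurd h (Order.not_isSuccLimit_succ k)⟩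
      rcases (Order.lt_succ_iff.1 hj).eq_or_lt with rfl | hj
      · exact hc1
      · exact (hr k hk.le j hj).2.le.trans hc1
    · obtain ⟨δ, hδS, hδ, hlh, hones⟩ := hl i hi hl'
      refine ⟨δ, hδS, fun j hj => hδ.1 ⟨j, hj, rfl⟩, ?_, hones, ?_, fun _ => hδ⟩
      · rw [hlh]
        exact Order.lt_add_one_iff.2 le_rfl
      · refine limit_mem_club (hC.mono (hpr i hi)) hl' hδ (hS.1 hδS)
          (fun j hj => (hr i hi j hj).1) fun j hj => ?_
        obtain ⟨c, -, hc1, hc2, -, hc3⟩ := hQ j (hj.trans_le hi)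
        exact ⟨c, hc1, hc2, hc3⟩
  choose! E hES hE1 hE2 hE3 hE4 hE5 using key
  have hle : ∀ i ≤ κ.ord, r i ≤ r κ.ord := fun i hi => by
    rcases hi.eq_or_lt with rfl | h
    · exact le_rfl
    · exact (hr _ le_rfl i h).1
  have hmono : ∀ i j, i < j → j ≤ κ.ord → E i < E j := fun i j hij hj =>
    (hE2 i (hij.le.trans hj)).trans_le (hE1 j hj i hij)
  refine ⟨r κ.ord, hpr _ le_rfl, E, hmono, closedBelow_image hmono fun i hi hl' ξ hξ => ?_,
    fun i hi => ⟨hES i hi, (hE4 i hi).mono (hle i hi), fun q hq =>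
      not_mem_W hreg (hE2 i hi) (hE3 i hi) q (le_trans (hle i hi : (r i : P) ≤ r κ.ord) hq)⟩⟩
  obtain ⟨_, ⟨j, hj, rfl⟩, hξj⟩ := (lt_isLUB_iff (hE5 i hi hl')).1 hξ
  have hj1 := hl'.succ_lt hj
  exact ⟨_, hj1, hξj.trans_le (hE1 _ (hj1.le.trans hi) j (Order.lt_succ j))⟩

theorem SparseName.isFat_sdiff (hreg : lam.IsRegular) (hunc : ℵ₀ < lam)
    (hGCH : GCHBelow lam) (hS : IsFat lam S) (σ : SparseName P lam S) (p : P) :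
    PName.isFat (PName.check lam.ord.toPSet)
      (PName.sdiff (PName.check (ordSet lam S)) σ.toExplicitName.W) p := by
  change PName.isFat (PName.ord lam.ord) _ p
  refine ⟨?_, ?_⟩
  · intro z q hq hz
    refine PName.mem_of_dense fun q' hq' => ?_
    obtain ⟨s, hs, _, ⟨a, rfl, -⟩, he⟩ := PName.mem_iff.1 hz q' hq'
    exact ⟨s, hs, (PName.mem_ord_iff.2 (Ordinal.ToType.mk.symm a.1).2).congr_left he.symm⟩
  · intro x q hq hx q1 hq1 hregx C q2 hq2 hC q3 hq3
    obtain ⟨s, hs, θ, hθ, he⟩ := (PName.ordRep_ord lam.ord q le_rfl x).1 hx q3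
      (hq1.trans (hq2.trans hq3))
    -- Once decided, θ is regular in the ground model, so the ground model construction applies to
    -- it.
    obtain ⟨κ, hκ, rfl⟩ := (hregx.mono (hq2.trans (hq3.trans hs))).exists_eq he
    obtain ⟨t, hst, E, hmono, hclosed, hE⟩ := σ.exists_closed_seq hreg hunc hGCH hS hκ
      (ord_lt_ord.1 hθ) (hC.mono (hq3.trans hs))
    have himage : range (fun i : (κ.ord + 1).ToType => E i) = E '' Iio (κ.ord + 1) := by
      ext η
      constructor
      · rintro ⟨i, rfl⟩
        exact ⟨i, (Ordinal.ToType.mk.symm i).2, rfl⟩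
      · rintro ⟨i, hi, rfl⟩
        exact ⟨Ordinal.ToType.mk ⟨i, hi⟩, by simp⟩
    have hD : PName.OrdRep (PName.mk (κ.ord + 1).ToType (fun i => PName.ord (E i)) fun _ => univ)
        (E '' Iio (κ.ord + 1)) (t : P) := PName.ordRep_mk _ himage
    refine ⟨t, hs.trans hst, _, ?_, ?_, PName.closedBelow_of_ordRep hD hclosed, fun v hv =>
      ⟨v, le_rfl, _, PName.isOrderIso_graph (PName.ordRep_succ (he.mono (hst.trans hv)))
        (hD.mono hv) fun i j hij hj => hmono i j hij (Order.lt_add_one_iff.1 hj)⟩⟩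
    · intro z v hv hz
      refine PName.mem_iff.2 fun v' hv' => ?_
      obtain ⟨w, hw, _, ⟨i, hi, rfl⟩, he'⟩ := (hD v hv z).1 hz v' hv'
      obtain ⟨h1, h2, h3⟩ := hE i (Order.lt_add_one_iff.1 hi)
      -- `w` itself is a condition attached to `E i` in the difference name, since it forces `E i`
      -- out of W_σ.
      refine ⟨w, hw, PName.ord (E i), ⟨⟨Ordinal.ToType.mk ⟨E i, hS.1 h1⟩, by simpa using h1⟩, ?_,
        w, ⟨⟨w, trivial, le_rfl⟩, ?_⟩, le_rfl⟩, he'⟩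
      · simp [PName.ord]
      · intro w' hw'
        simpa [PName.ord] using h3 w' (hv.trans (hv'.trans (hw.trans hw')))
    · intro z v hv hz
      refine PName.mem_of_dense fun v' hv' => ?_
      obtain ⟨w, hw, _, ⟨i, hi, rfl⟩, he'⟩ := (hD v hv z).1 hz v' hv'
      exact ⟨w, hw, ((hE i (Order.lt_add_one_iff.1 hi)).2.1.mono
        (hv.trans (hv'.trans hw))).congr_left he'.symm⟩

theorem mainTheorem9 (lam : Cardinal.{u}) (hreg : lam.IsRegular) (hunc : ℵ₀ < lam)
    (hGCH : GCHBelow lam) (S : Set Ordinal.{u}) (hS : IsFat lam S)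
    (P : Type u) [Preorder P] (σ : SparseName P lam S) :
    IsDistributive P lam ∧
      ∀ p : P, PName.isFat (PName.check lam.ord.toPSet)
        (PName.sdiff (PName.check (ordSet lam S)) σ.toExplicitName.W) p :=
  ⟨σ.isDistributive hreg hunc hGCH hS, σ.isFat_sdiff hreg hunc hGCH hS⟩
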